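/- Let $k$ be a perfect field of characteristic $p>0$. Let $\mathfrak g,\mathfrak h$ be finite-dimensional abelian restricted Lie algebras over $k$ with $\mathfrak g=kz$, $z\neq 0$, $z^{[p]}+\lambda z=0$ for some $\lambda\in k$, and let $\rho$ be an algebraic representation of $\mathfrak g$ on $\mathfrak h$, i.e. a linear map $\rho:\mathfrak g\to \mathrm{End}_k(\mathfrak h)$ (with commuting values) such that $\rho_{x^{[p]}}=(\rho_x)^p$ and $\rho_x(a^{[p]})=0$ for $x\in\mathfrak g$, $a\in\mathfrak h$. Put $T=(\mathfrak g,\mathfrak h,\rho)$ and let $A=u(\mathfrak h)$, $B=u(\mathfrak g)$ be the restricted universal enveloping algebras, with $\Delta(x)=x\otimes 1+1\otimes x$ for primitive generators $x$, and let $A^+$ be the augmentation ideal of $A$. Let $\rho_z$ act on $A$ as the derivation extending $\rho_z$ on $\mathfrak h$, and on $A\otimes A$ as $\rho_z\otimes 1+1\otimes\rho_z$. Let $\overline\Delta(a)=\Delta(a)-a\otimes 1-1\otimes a$, and let $d^1=-\overline\Delta$ on $A^+$ and $d^2=-\overline\Delta\otimes 1+1\otimes\overline\Delta$ on $A^+\otimes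 A^+$ be the first differentials of the cobar construction $\Omega A$, with $Z^2(\Omega A)=\ker d^2$ and $B^2(\Omega A)=d^1(A^+)$. On $A$ and on $A\otimes A$ put $\Phi_z(f)=f^p+\rho_z^{p-1}(f)+\lambda f$. Let $\mathcal E^2(B,A)$ be the set of all $(\Theta,\chi)\in A^+\times Z^2(\Omega A)$ with $\rho_z(\Theta)=0$ and $\Phi_z(\chi)=d^1(\Theta)$, and let $\mathcal L^2(\mathfrak g,\mathfrak h)$ be the subset of those with $\chi\in B^2(\Omega A)$. Write $(\Theta',\chi')\sim(\Theta,\chi)$ if there is $a\in A^+$ with $\Theta'-\Theta=\Phi_z(a)$ and $\chi'-\chi=d^1(a)$. Put $\mathcal H^2(B,A)=\mathcal E^2(B,A)/{\sim}$, $\mathcal H^2(\mathfrak g,\mathfrak h)=\mathcal L^2(\mathfrak g,\mathfrak h)/{\sim}$ and $\mathcal H^2(T)=\mathcal H^2(B,A)\setminus\mathcal H^2(\mathfrak g,\mathfrak h)$. Fix a basis $x_1,\dots,x_d$ of $\mathfrak h$ and let $A_{\ge 2}\subset A$ be the span of the monomials $x_1^{\sigma_1}\cdots x_d^{\sigma_d}$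 with $0\le\sigma_i\le p-1$ and $\sum_i\sigma_i\ge 2$. For $x\in\mathfrak h$ let $\omega(x)=\sum_{i=1}^{p-1}\frac1p\binom pi\,x^i\otimes x^{p-i}$. For a $k$-point $P=(a_i,b_{ij},c_l)$ of $\mathbb A^d\times\mathbb A^{d(d+1)/2}$, with coordinates $a_i$ ($1\le i\le d$) on the first factor and $b_{ij}$ ($1\le i<j\le d$), $c_l$ ($1\le l\le d$) on the second, put $$\Theta_P=\sum_i a_ix_i,\qquad \chi_P=\sum_{i<j}b_{ij}\,x_i\otimes x_j+\omega\Big(\sum_l c_lx_l\Big).$$ Let $S_T$ be the set of all $P$ such that $\chi_P\notin B^2(\Omega A)$ and there is $a\in A_{\ge 2}$ with $\Phi_z(\chi_P)=d^1(a)$ and $\rho_z(a+\Theta_P)=0$. Let $\mathfrak h$ act on $\mathbb A^d\cong\mathfrak h$ by $v\cdot y=y+\Phi_z(v)$, with orbit set $\mathbb A^d/\mathfrak h$, and let $\pi:\mathbb A^d\times\mathbb A^{d(d+1)/2}\to(\mathbb A^d/\mathfrak h)\times\mathbb A^{d(d+1)/2}$ be the quotient map. Then, for every $P\in S_T$, the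 element $a\in A_{\ge 2}$ with $\Phi_z(\chi_P)=d^1(a)$ is unique; denote it by $\Psi_P$. The pairs $(\Psi_P+\Theta_P,\chi_P)$ with $P\in S_T$ lie in $\mathcal E^2(B,A)\setminus\mathcal L^2(\mathfrak g,\mathfrak h)$, and every element of $\mathcal E^2(B,A)\setminus\mathcal L^2(\mathfrak g,\mathfrak h)$ is equivalent under $\sim$ to one of them. Moreover, $\pi(P)\mapsto[(\Psi_P+\Theta_P,\chi_P)]$ is a well-defined bijection from $\pi(S_T)$ onto $\mathcal H^2(T)$. -/

import Mathlib

open scoped TensorProduct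

noncomputable section

namespace ConnHopf

/-! ### Restricted enveloping algebras of abelian restricted Lie algebras

An abelian restricted Lie algebra over a field `k` of characteristic `p` is a vector space `h`
(with zero bracket) together with a `p`-map `q : h → h`, `x ↦ x^[p]`.  For the zero bracket the
axioms of a `p`-map say exactly that `q` is additive and satisfies `(c x)^[p] = c ^ p x^[p]`, i.e.
that `q` is semilinear with respect to the Frobenius endomorphism of `k`. -/

section Enveloping

variable {k : Type*} [Field k] {p : ℕ} [Fact p.Prime] [CharP k p]
variable {h : Type*} [AddCommGroup h] [Module k h]

/-- The ideal of `S(h)`, the (usual) enveloping algebra of the abelian Lie algebra `h`, generated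
by the elements `x ^ p - x^[p]` with `x ∈ h`. -/
def restrictedIdeal (q : h →ₛₗ[frobenius k p] h) : Ideal (SymmetricAlgebra k h) :=
  Ideal.span (Set.range fun x : h =>
    SymmetricAlgebra.ι k h x ^ p - SymmetricAlgebra.ι k h (q x))

/-- The restricted universal enveloping algebra `u(h)` of the abelian restricted Lie algebra
`(h, q)`. -/
def RestrictedEnv (q : h →ₛₗ[frobenius k p] h) : Type _ :=
  SymmetricAlgebra k h ⧸ restrictedIdeal q

instance (q : h →ₛₗ[frobenius k p] h) : CommRing (RestrictedEnv q) :=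
  inferInstanceAs (CommRing (SymmetricAlgebra k h ⧸ restrictedIdeal q))

instance (q : h →ₛₗ[frobenius k p] h) : Algebra k (RestrictedEnv q) :=
  inferInstanceAs (Algebra k (SymmetricAlgebra k h ⧸ restrictedIdeal q))

namespace RestrictedEnv

variable (q : h →ₛₗ[frobenius k p] h)

/-- The quotient map `S(h) → u(h)`. -/
def mkHom : SymmetricAlgebra k h →ₐ[k] RestrictedEnv q :=
  Ideal.Quotient.mkₐ k (restrictedIdeal q)

/-- The canonical map `h → u(h)`. -/
def ι : h →ₗ[k] RestrictedEnv q := (mkHom q).toLinearMap ∘ₗ SymmetricAlgebra.ι k h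

lemma ι_pow (x : h) : ι q x ^ p = ι q (q x) := by
  have hx : mkHom q (SymmetricAlgebra.ι k h x ^ p - SymmetricAlgebra.ι k h (q x)) = 0 :=
    Ideal.Quotient.eq_zero_iff_mem.2 (Ideal.subset_span ⟨x, rfl⟩)
  rw [map_sub, map_pow, sub_eq_zero] at hx
  exact hx

/-- The universal property of `u(h)`: a linear map `f` from `h` to a commutative algebra with
`f x ^ p = f (x^[p])` extends to an algebra map on `u(h)`. -/
def lift {R : Type*} [CommRing R] [Algebra k R] (f : h →ₗ[k] R)
    (hf : ∀ x, f x ^ p = f (q x)) : RestrictedEnv q →ₐ[k] R :=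
  Ideal.Quotient.liftₐ (restrictedIdeal q) (SymmetricAlgebra.lift f) (by
    have hle : restrictedIdeal q ≤ RingHom.ker (SymmetricAlgebra.lift f) := by
      refine Ideal.span_le.2 ?_
      rintro _ ⟨x, rfl⟩
      simp [RingHom.mem_ker, hf]
    intro a ha
    exact hle ha)

@[simp]
lemma lift_ι {R : Type*} [CommRing R] [Algebra k R] (f : h →ₗ[k] R)
    (hf : ∀ x, f x ^ p = f (q x)) (x : h) : lift q f hf (ι q x) = f x :=
  SymmetricAlgebra.lift_ι_apply f x

lemma algHom_ext {R : Type*} [CommRing R] [Algebra k R] {F G : RestrictedEnv q →ₐ[k] R}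
    (hFG : ∀ x, F (ι q x) = G (ι q x)) : F = G := by
  have hc : F.comp (mkHom q) = G.comp (mkHom q) :=
    SymmetricAlgebra.algHom_ext (LinearMap.ext hFG)
  refine AlgHom.ext fun a => ?_
  obtain ⟨b, rfl⟩ := Ideal.Quotient.mk_surjective a
  exact congrArg (fun φ => φ b) hc

/-- The additivity of the `p`-th power map on a commutative `k`-algebra. -/
lemma add_pow_p (k : Type*) [Field k] {p : ℕ} [Fact p.Prime] [CharP k p] {R : Type*}
    [CommRing R] [Algebra k R] (x y : R) : (x + y) ^ p = x ^ p + y ^ p := by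
  rcases subsingleton_or_nontrivial R with hR | hR
  · exact Subsingleton.elim _ _
  · have : CharP R p := charP_of_injective_algebraMap (algebraMap k R).injective p
    exact add_pow_char x y p

/-- The counit `ε : u(h) → k`, with `ε x = 0` for `x ∈ h`. -/
def counit : RestrictedEnv q →ₐ[k] k :=
  lift q 0 (fun x => by simp [(Fact.out : p.Prime).ne_zero])

/-- The comultiplication `Δ : u(h) → u(h) ⊗ u(h)`, with `Δ x = x ⊗ 1 + 1 ⊗ x` for `x ∈ h`. -/
def comul : RestrictedEnv q →ₐ[k] RestrictedEnv q ⊗[k] RestrictedEnv q :=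
  lift q
    ((TensorProduct.mk k (RestrictedEnv q) (RestrictedEnv q)).flip 1 ∘ₗ ι q +
      TensorProduct.mk k (RestrictedEnv q) (RestrictedEnv q) 1 ∘ₗ ι q)
    (fun x => by
      simp [add_pow_p k, Algebra.TensorProduct.tmul_pow, ι_pow])

lemma counit_ι (x : h) : counit q (ι q x) = 0 := by simp [counit]

lemma comul_ι (x : h) : comul q (ι q x) = ι q x ⊗ₜ 1 + 1 ⊗ₜ ι q x :=
  lift_ι q _ _ x

/-- The augmentation ideal `A⁺ = ker ε` of `A = u(h)`. -/
def aug : Submodule k (RestrictedEnv q) := LinearMap.ker (counit q).toLinearMap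

/-! ### The cobar construction in degrees at most three

The component of degree `n` is `(A⁺)^{⊗ n}`, regarded inside `A^{⊗ n}`; the differentials are
given by formulas on all of `A` and `A ⊗ A`, and are used on `A⁺` and `A⁺ ⊗ A⁺` only. -/

/-- `A⁺ ⊗ A⁺` as a subspace of `A ⊗ A`. -/
def aug2 : Submodule k (RestrictedEnv q ⊗[k] RestrictedEnv q) :=
  LinearMap.range (TensorProduct.map (aug q).subtype (aug q).subtype)

/-- The reduced comultiplication `a ↦ Δ a - a ⊗ 1 - 1 ⊗ a`. -/
def redComul : RestrictedEnv q →ₗ[k] RestrictedEnv q ⊗[k] RestrictedEnv q :=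
  (comul q).toLinearMap - (TensorProduct.mk k (RestrictedEnv q) (RestrictedEnv q)).flip 1 -
    TensorProduct.mk k (RestrictedEnv q) (RestrictedEnv q) 1

/-- The differential `d¹`, minus the reduced comultiplication. -/
def d1 : RestrictedEnv q →ₗ[k] RestrictedEnv q ⊗[k] RestrictedEnv q := -redComul q

/-- The differential `d²`: if `δ` is the reduced comultiplication, then
`d² (a ⊗ b) = - δ a ⊗ b + a ⊗ δ b`. -/
def d2 : RestrictedEnv q ⊗[k] RestrictedEnv q →ₗ[k]
    RestrictedEnv q ⊗[k] (RestrictedEnv q ⊗[k] RestrictedEnv q) :=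
  -((TensorProduct.assoc k (RestrictedEnv q) (RestrictedEnv q) (RestrictedEnv q)).toLinearMap ∘ₗ
      LinearMap.rTensor (RestrictedEnv q) (redComul q)) +
    LinearMap.lTensor (RestrictedEnv q) (redComul q)

/-- The 2-cocycles `Z²(ΩA) ⊆ A⁺ ⊗ A⁺`. -/
def Z2 : Submodule k (RestrictedEnv q ⊗[k] RestrictedEnv q) := aug2 q ⊓ LinearMap.ker (d2 q)

/-- The 2-coboundaries `B²(ΩA) = d¹(A⁺)`. -/
def B2 : Submodule k (RestrictedEnv q ⊗[k] RestrictedEnv q) := (aug q).map (d1 q)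

/-- `ω(x) = ∑_{0 < i < p} (p choose i)/p x ^ i ⊗ x ^ (p - i)`; the division of the natural number
`p choose i` by `p` is exact. -/
def omega (x : RestrictedEnv q) : RestrictedEnv q ⊗[k] RestrictedEnv q :=
  ∑ i ∈ Finset.Ioo 0 p, ((p.choose i / p : ℕ) : k) • ((x ^ i) ⊗ₜ[k] (x ^ (p - i)))

/-- For a basis `x₁, …, x_d` of `h`, the subspace `A_{≥ 2}` of `A = u(h)` spanned by the
monomials `x₁ ^ σ₁ ⋯ x_d ^ σ_d` with all `σ_i ≤ p - 1` and `σ₁ + ⋯ + σ_d ≥ 2`. -/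
def ge2 {d : ℕ} (x : Module.Basis (Fin d) k h) : Submodule k (RestrictedEnv q) :=
  Submodule.span k {m | ∃ σ : Fin d → ℕ, (∀ i, σ i < p) ∧ 2 ≤ ∑ i, σ i ∧
    m = ∏ i, ι q (x i) ^ σ i}

end RestrictedEnv

end Enveloping

/-! ### Types -/

/-- A triple `(g, h, ρ)` of abelian restricted Lie algebras `g`, `h` (with zero brackets and
`p`-maps `pg`, `ph`) and an algebraic representation `ρ` of `g` on `h` by linear maps: `ρ` is
linear, compatible with brackets (so the operators `ρ x` commute), `ρ (x^[p]) = (ρ x) ^ p`, each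
`ρ x` is a derivation of the (zero) bracket of `h`, and `ρ x (a^[p]) = ρ x (a) (ad a) ^ (p - 1)`,
which is `0` since `ad a = 0` and `p - 1 ≥ 1`. -/
structure RepType (k : Type*) [Field k] (p : ℕ) [Fact p.Prime] [CharP k p]
    (g h : Type*) [AddCommGroup g] [Module k g] [AddCommGroup h] [Module k h] where
  /-- the `p`-map of `g` -/
  pg : g →ₛₗ[frobenius k p] g
  /-- the `p`-map of `h` -/
  ph : h →ₛₗ[frobenius k p] h
  /-- the representation -/
  rho : g →ₗ[k] Module.End k h
  rho_comm : ∀ x y, rho x * rho y - rho y * rho x = 0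
  rho_pg : ∀ x, rho (pg x) = rho x ^ p
  rho_ph : ∀ x a, rho x (ph a) = 0

namespace RepType

variable {k : Type*} [Field k] {p : ℕ} [Fact p.Prime] [CharP k p]
variable {g h : Type*} [AddCommGroup g] [Module k g] [AddCommGroup h] [Module k h]
variable (T : RepType k p g h)

/-- The Hopf algebra `A = u(h)`. -/
abbrev A : Type _ := RestrictedEnv T.ph

/-- The algebra map `A → A[ε]` (dual numbers) with `v ↦ v + ρ_x(v) ε` for `v ∈ h`. -/
def actDual (x : g) : T.A →ₐ[k] TrivSqZeroExt T.A T.A :=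
  RestrictedEnv.lift T.ph
    ((TrivSqZeroExt.inlAlgHom k T.A T.A).toLinearMap ∘ₗ RestrictedEnv.ι T.ph +
      (TrivSqZeroExt.inrHom T.A T.A).restrictScalars k ∘ₗ RestrictedEnv.ι T.ph ∘ₗ T.rho x)
    (fun v => by
      have hp : ((p : ℕ) : T.A) = 0 := by
        rw [← map_natCast (algebraMap k T.A), CharP.cast_eq_zero, map_zero]
      ext
      · simp [TrivSqZeroExt.fst_pow, RestrictedEnv.ι_pow]
      · simp [TrivSqZeroExt.snd_pow, T.rho_ph, nsmul_eq_mul, hp])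

/-- The action of `x ∈ g` on `A = u(h)`: the derivation of `A` which extends `ρ_x`. -/
def act (x : g) : T.A →ₗ[k] T.A :=
  (TrivSqZeroExt.sndHom T.A T.A).restrictScalars k ∘ₗ (T.actDual x).toLinearMap

lemma act_ι (x : g) (v : h) :
    T.act x (RestrictedEnv.ι T.ph v) = RestrictedEnv.ι T.ph (T.rho x v) := by
  simp [act, actDual]

lemma fst_actDual (x : g) (a : T.A) : (T.actDual x a).fst = a := by
  have hid : (TrivSqZeroExt.fstHom k T.A T.A).comp (T.actDual x) = AlgHom.id k T.A :=
    RestrictedEnv.algHom_ext T.ph (fun v => by simp [actDual])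
  exact congrArg (fun φ => φ a) hid

lemma act_mul (x : g) (a b : T.A) : T.act x (a * b) = T.act x a * b + a * T.act x b := by
  have ha := T.fst_actDual x a
  have hb := T.fst_actDual x b
  simp only [act, LinearMap.comp_apply, AlgHom.toLinearMap_apply, map_mul,
    LinearMap.restrictScalars_apply, TrivSqZeroExt.sndHom_apply, TrivSqZeroExt.snd_mul, ha, hb,
    smul_eq_mul, MulOpposite.smul_eq_mul_unop, MulOpposite.unop_op]
  ring

/-- The action of the primitive element `x ∈ g` on `A ⊗ A`, `a ⊗ b ↦ ρ_x a ⊗ b + a ⊗ ρ_x b`. -/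
def act2 (x : g) : T.A ⊗[k] T.A →ₗ[k] T.A ⊗[k] T.A :=
  LinearMap.rTensor T.A (T.act x) + LinearMap.lTensor T.A (T.act x)

/-- The `z`-operator `Φ_z(a) = a ^ p + ρ_z ^ (p - 1) (a) + lam a` in degree one,
for `z^[p] + lam z = 0`. -/
def phi1 (z : g) (lam : k) (a : T.A) : T.A := a ^ p + (T.act z ^ (p - 1)) a + lam • a

/-- The `z`-operator `Φ_z(f) = f ^ p + ρ_z ^ (p - 1) (f) + lam f` in degree two,
for `z^[p] + lam z = 0`. -/
def phi2 (z : g) (lam : k) (f : T.A ⊗[k] T.A) : T.A ⊗[k] T.A :=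
  f ^ p + (T.act2 z ^ (p - 1)) f + lam • f

/-- The restriction of `Φ_z` to `h`, as an additive map to `h`. -/
def phiH (z : g) (lam : k) : h →+ h where
  toFun v := T.ph v + (T.rho z ^ (p - 1)) v + lam • v
  map_zero' := by simp
  map_add' v w := by
    simp only [map_add, smul_add]
    abel

lemma phi1_ι (z : g) (lam : k) (v : h) :
    T.phi1 z lam (RestrictedEnv.ι T.ph v) = RestrictedEnv.ι T.ph (T.phiH z lam v) := by
  have hpow : ∀ n : ℕ, (T.act z ^ n) (RestrictedEnv.ι T.ph v) =
      RestrictedEnv.ι T.ph ((T.rho z ^ n) v) := by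
    intro n
    induction n with
    | zero => simp
    | succ n ih => rw [pow_succ', pow_succ', Module.End.mul_apply, ih, act_ι, Module.End.mul_apply]
  simp [phi1, phiH, hpow, RestrictedEnv.ι_pow]

lemma phi1_zero (z : g) (lam : k) : T.phi1 z lam 0 = 0 := by
  simp [phi1, (Fact.out : p.Prime).ne_zero]

lemma phi1_add (z : g) (lam : k) (a b : T.A) :
    T.phi1 z lam (a + b) = T.phi1 z lam a + T.phi1 z lam b := by
  simp only [phi1, RestrictedEnv.add_pow_p k, map_add, smul_add]
  abel

/-! ### The sets `𝓔²(B,A)`, `𝓛²(g,h)` and the cohomology sets -/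

/-- `𝓔²(B,A) ⊆ A⁺ × Z²(ΩA)`: the pairs `(Θ, χ)` with `ρ_z(Θ) = 0` and `Φ_z(χ) = d¹(Θ)`. -/
def E2 (z : g) (lam : k) : Set (T.A × (T.A ⊗[k] T.A)) :=
  {X | X.1 ∈ RestrictedEnv.aug T.ph ∧ X.2 ∈ RestrictedEnv.Z2 T.ph ∧
    T.act z X.1 = 0 ∧ T.phi2 z lam X.2 = RestrictedEnv.d1 T.ph X.1}

/-- `𝓛²(g,h) ⊆ A⁺ × B²(ΩA)`, defined by the same two equations. -/
def L2 (z : g) (lam : k) : Set (T.A × (T.A ⊗[k] T.A)) :=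
  {X | X.1 ∈ RestrictedEnv.aug T.ph ∧ X.2 ∈ RestrictedEnv.B2 T.ph ∧
    T.act z X.1 = 0 ∧ T.phi2 z lam X.2 = RestrictedEnv.d1 T.ph X.1}

/-- `(Θ', χ') ∼ (Θ, χ)` if `Θ' - Θ = Φ_z(a)` and `χ' - χ = d¹(a)` for some `a ∈ A⁺`. -/
def Equivalent (z : g) (lam : k) (X Y : T.A × (T.A ⊗[k] T.A)) : Prop :=
  ∃ a ∈ RestrictedEnv.aug T.ph,
    X.1 - Y.1 = T.phi1 z lam a ∧ X.2 - Y.2 = RestrictedEnv.d1 T.ph a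

lemma equivalence_equivalent (z : g) (lam : k) : Equivalence (T.Equivalent z lam) where
  refl X := ⟨0, Submodule.zero_mem _, by simp [phi1_zero], by simp⟩
  symm := by
    rintro X Y ⟨a, ha, h1, h2⟩
    refine ⟨-a, Submodule.neg_mem _ ha, ?_, ?_⟩
    · have hs := T.phi1_add z lam a (-a)
      rw [add_neg_cancel, phi1_zero, ← h1] at hs
      rw [← neg_sub, eq_comm, ← add_eq_zero_iff_eq_neg, add_comm]
      exact hs.symm
    · rw [map_neg, ← h2, neg_sub]
  trans := by
    rintro X Y Z ⟨a, ha, h1, h2⟩ ⟨b, hb, h3, h4⟩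
    refine ⟨a + b, Submodule.add_mem _ ha hb, ?_, ?_⟩
    · rw [phi1_add, ← h1, ← h3, sub_add_sub_cancel]
    · rw [map_add, ← h2, ← h4, sub_add_sub_cancel]

/-- The equivalence relation `∼` on `𝓔²(B,A)`. -/
def setoidE2 (z : g) (lam : k) : Setoid (T.E2 z lam) where
  r X Y := T.Equivalent z lam X.1 Y.1
  iseqv :=
    ⟨fun X => (T.equivalence_equivalent z lam).refl X.1,
      fun hXY => (T.equivalence_equivalent z lam).symm hXY,
      fun hXY hYZ => (T.equivalence_equivalent z lam).trans hXY hYZ⟩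

/-- `𝓗²(B,A) = 𝓔²(B,A)/∼`. -/
def H2BA (z : g) (lam : k) : Type _ := Quotient (T.setoidE2 z lam)

/-- The class in `𝓗²(B,A)` of an element of `𝓔²(B,A)`. -/
def cls (z : g) (lam : k) (X : T.A × (T.A ⊗[k] T.A)) (hX : X ∈ T.E2 z lam) : T.H2BA z lam :=
  Quotient.mk (T.setoidE2 z lam) ⟨X, hX⟩

/-- `𝓗²(g,h) = 𝓛²(g,h)/∼` as a subset of `𝓗²(B,A)`. -/
def H2gh (z : g) (lam : k) : Set (T.H2BA z lam) :=
  {c | ∃ (X : T.A × (T.A ⊗[k] T.A)) (hX : X ∈ T.E2 z lam), X ∈ T.L2 z lam ∧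
    c = T.cls z lam X hX}

/-- `𝓗²(T) = 𝓗²(B,A) ∖ 𝓗²(g,h)`. -/
def H2T (z : g) (lam : k) : Set (T.H2BA z lam) := (T.H2gh z lam)ᶜ

end RepType

/-! ### The points `P` and the set `S_T` -/

/-- The `k`-points of `𝔸^d × 𝔸^{d(d+1)/2}`: a point is `P = (a, b, c)` with coordinates `a_i`,
`b_{ij}` for `i < j`, and `c_l`; the last two families together are the coordinates of
`𝔸^{d(d+1)/2}`. -/
abbrev Points (k : Type*) (d : ℕ) : Type _ :=
  (Fin d → k) × (({ij : Fin d × Fin d // ij.1 < ij.2} → k) × (Fin d → k))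

namespace RepType

variable {k : Type*} [Field k] {p : ℕ} [Fact p.Prime] [CharP k p]
variable {g h : Type*} [AddCommGroup g] [Module k g] [AddCommGroup h] [Module k h]
variable (T : RepType k p g h) {d : ℕ} (x : Module.Basis (Fin d) k h)

/-- `Θ_P = ∑ a_i x_i`. -/
def thetaP (P : Points k d) : T.A := RestrictedEnv.ι T.ph (∑ i, P.1 i • x i)

/-- `χ_P = ∑_{i < j} b_{ij} x_i ⊗ x_j + ω (∑ c_i x_i)`. -/
def chiP (P : Points k d) : T.A ⊗[k] T.A :=
  ∑ ij, P.2.1 ij •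
      (RestrictedEnv.ι T.ph (x ij.1.1) ⊗ₜ[k] RestrictedEnv.ι T.ph (x ij.1.2)) +
    RestrictedEnv.omega T.ph (RestrictedEnv.ι T.ph (∑ i, P.2.2 i • x i))

/-- The set `S_T` of all points `P` such that `χ_P` is not a coboundary and there is an
`a ∈ A_{≥ 2}` with `Φ_z(χ_P) = d¹(a)` and `ρ_z(a + Θ_P) = 0`. -/
def ST (z : g) (lam : k) : Set (Points k d) :=
  {P | T.chiP x P ∉ RestrictedEnv.B2 T.ph ∧ ∃ a ∈ RestrictedEnv.ge2 T.ph x,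
    T.phi2 z lam (T.chiP x P) = RestrictedEnv.d1 T.ph a ∧ T.act z (a + T.thetaP x P) = 0}

/-- The element `Ψ_P ∈ A_{≥ 2}` for `P ∈ S_T`: an `a ∈ A_{≥ 2}` as in the definition of `S_T`.
That it is determined by `χ_P` is part of the theorem. -/
def psiP (z : g) (lam : k) (P : T.ST x z lam) : T.A := P.2.2.choose

/-- The pair `(Ψ_P + Θ_P, χ_P)` for `P ∈ S_T`. -/
def pairP (z : g) (lam : k) (P : T.ST x z lam) : T.A × (T.A ⊗[k] T.A) :=
  (T.psiP x z lam P + T.thetaP x P.1, T.chiP x P.1)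

/-- The translations of `𝔸^d ≅ h` (coordinates in the basis `x`) by the elements `Φ_z(v)`,
`v ∈ h`. -/
def translations (z : g) (lam : k) : AddSubgroup (Fin d → k) :=
  (x.equivFun.toAddEquiv.toAddMonoidHom.comp (T.phiH z lam)).range

/-- The quotient `𝔸^d/h` by the action `v · y = y + Φ_z(v)` of `h` on `𝔸^d`; its elements are
the orbits, which are the cosets of the group of all translations. -/
abbrev AffineQuot (z : g) (lam : k) : Type _ := (Fin d → k) ⧸ T.translations x z lam

/-- The quotient map `π : 𝔸^d × 𝔸^{d(d+1)/2} → (𝔸^d/h) × 𝔸^{d(d+1)/2}`. -/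
def quotMap (z : g) (lam : k) (P : Points k d) : T.AffineQuot x z lam ×
    (({ij : Fin d × Fin d // ij.1 < ij.2} → k) × (Fin d → k)) :=
  (QuotientAddGroup.mk P.1, P.2)

end RepType

end ConnHopf

end

/-! The proof computes the degree-two cobar cohomology of `A = u(h)` in explicit coordinates. The
monomials with exponents below `p` form a basis of `A`. After division by factorials they become
divided powers, for which the `(s, t)` coordinate of `Δ a` is the `s + t` coordinate of `a`
(`coord2_comul`). An element of `A⁺ ⊗ A⁺` is then a function `F(s, t)` of nonzero exponents. It is a
cocycle iff `F(r, s + t) = F(r + s, t)`, and a coboundary iff `F(s, t) = G(s + t)` with `G`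
supported on exponents below `p`.

For a cocycle, only two things obstruct the existence of `G` (`exists_of_balanced`): the
antisymmetric part of `F` at pairs of unit exponents, and the values `F(e_i, (p - 1) e_i)`. On `χ_P`
these are `b_ij` and `(p - 1)! c_i ^ p`. Since `k` is perfect, every class contains a `χ_P` for
exactly one `(b, c)` (`exists_chiP`, `eq_of_chiP_sub`).

It remains to treat `Θ`. The operator `Φ_z` commutes with `d¹` (`d1_phi1`), and `ρ_z ∘ Φ_z = 0` on
`A` (`act_phi1`), so `χ` may be moved to `χ_P` inside its equivalence class. The kernel of `d¹` on
`A⁺` is `h`, and `A⁺ = A_{≥ 2} ⊕ h`. Hence `Θ` splits into `Ψ_P`, determined by `χ_P`, and a free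
part `Θ_P`. An equivalence between two such pairs fixes `χ_P`, so it comes from some `v ∈ h` and
translates `Θ_P` by `Φ_z(v)`. -/

namespace ConnHopf

/-! ### Normal forms of polynomials modulo the relations `X_i ^ p = L_i`. -/

noncomputable section PolynomialNormalForm

open MvPolynomial

variable {k : Type*} [Field k] {d : ℕ}

/-- The polynomials of total degree less than `n`. -/
def degLT (k : Type*) [Field k] (d n : ℕ) : Submodule k (MvPolynomial (Fin d) k) :=
  restrictSupport k {m | m.degree < n}

lemma mem_degLT {n : ℕ} {f : MvPolynomial (Fin d) k} :
    f ∈ degLT k d n ↔ ∀ m ∈ f.support, m.degree < n := by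
  simp [degLT, mem_restrictSupport_iff, Set.subset_def]

lemma degLT_mono {m n : ℕ} (hmn : m ≤ n) : degLT k d m ≤ degLT k d n := by
  intro f hf
  rw [mem_degLT] at hf ⊢
  exact fun s hs => (hf s hs).trans_le hmn

lemma eq_zero_of_mem_degLT_zero {f : MvPolynomial (Fin d) k} (hf : f ∈ degLT k d 0) : f = 0 := by
  rw [mem_degLT] at hf
  rw [← support_eq_empty, Finset.eq_empty_iff_forall_notMem]
  exact fun m hm => absurd (hf m hm) (Nat.not_lt_zero _)

lemma exists_mem_degLT (f : MvPolynomial (Fin d) k) : ∃ n, f ∈ degLT k d n := by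
  refine ⟨f.support.sup (fun m => m.degree) + 1, ?_⟩
  rw [mem_degLT]
  exact fun m hm => Nat.lt_succ_of_le (Finset.le_sup (f := fun m => m.degree) hm)

/-- The bounds are asymmetric, strict for `f` and weak for `g`, so that a lower-order error times a
factor of full degree remains an error. -/
lemma mul_mem_degLT {m n : ℕ} {f g : MvPolynomial (Fin d) k} (hf : f ∈ degLT k d m)
    (hg : g ∈ degLT k d (n + 1)) : f * g ∈ degLT k d (m + n) := by
  rw [mem_degLT] at hf hg ⊢
  intro s hs
  obtain ⟨a, ha, b, hb, rfl⟩ := Finset.mem_add.1 (support_mul f g hs)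
  have h1 := hf a ha
  have h2 := hg b hb
  rw [map_add]
  omega

lemma mem_degLT_of_totalDegree_lt {n : ℕ} {f : MvPolynomial (Fin d) k} (hf : f.totalDegree < n) :
    f ∈ degLT k d n := by
  rw [mem_degLT]
  intro m hm
  exact (le_totalDegree hm).trans_lt hf

/-- `f` and `g` have degree at most `n` and the same component of degree `n`. -/
def SameTop (n : ℕ) (f g : MvPolynomial (Fin d) k) : Prop :=
  f ∈ degLT k d (n + 1) ∧ g ∈ degLT k d (n + 1) ∧ f - g ∈ degLT k d n

lemma SameTop.refl {n : ℕ} {f : MvPolynomial (Fin d) k} (hf : f ∈ degLT k d (n + 1)) :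
    SameTop n f f := ⟨hf, hf, by simp⟩

lemma SameTop.mul {m n : ℕ} {f g f' g' : MvPolynomial (Fin d) k} (hf : SameTop m f f')
    (hg : SameTop n g g') : SameTop (m + n) (f * g) (f' * g') := by
  obtain ⟨h1, h2, h3⟩ := hf
  obtain ⟨h4, h5, h6⟩ := hg
  refine ⟨?_, ?_, ?_⟩
  · rw [Nat.add_right_comm]; exact mul_mem_degLT h1 h4
  · rw [Nat.add_right_comm]; exact mul_mem_degLT h2 h5
  · have : f * g - f' * g' = (f - f') * g + (g - g') * f' := by ring
    rw [this]
    refine add_mem (mul_mem_degLT h3 h4) ?_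
    rw [add_comm m n]
    exact mul_mem_degLT h6 h2

lemma sameTop_one : SameTop 0 (1 : MvPolynomial (Fin d) k) 1 :=
  SameTop.refl (mem_degLT_of_totalDegree_lt (by simp))

lemma SameTop.pow {m : ℕ} {f f' : MvPolynomial (Fin d) k} (hf : SameTop m f f') (n : ℕ) :
    SameTop (m * n) (f ^ n) (f' ^ n) := by
  induction n with
  | zero => simpa using sameTop_one
  | succ n ih => rw [pow_succ, pow_succ, Nat.mul_succ]; exact ih.mul hf

lemma SameTop.prod {ι : Type*} (s : Finset ι) {m : ι → ℕ} {f f' : ι → MvPolynomial (Fin d) k}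
    (hf : ∀ i, SameTop (m i) (f i) (f' i)) :
    SameTop (∑ i ∈ s, m i) (∏ i ∈ s, f i) (∏ i ∈ s, f' i) := by
  classical
  induction s using Finset.induction_on with
  | empty => simpa using sameTop_one
  | insert a s ha ih =>
    rw [Finset.sum_insert ha, Finset.prod_insert ha, Finset.prod_insert ha]
    exact (hf a).mul ih

variable (p : ℕ) (L : Fin d → MvPolynomial (Fin d) k)

/-- The linear endomorphism of `k[X₁, …, X_d]` which replaces `X_i ^ p` by `X_i ^ p - L_i` in the
monomials. -/
def powSubst : MvPolynomial (Fin d) k →ₗ[k] MvPolynomial (Fin d) k :=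
  (basisMonomials (Fin d) k).constr k
    (fun m => ∏ i, (X i ^ (m i % p) * (X i ^ p - L i) ^ (m i / p)))

lemma powSubst_monomial (m : Fin d →₀ ℕ) :
    powSubst p L (monomial m 1) = ∏ i, (X i ^ (m i % p) * (X i ^ p - L i) ^ (m i / p)) := by
  have := (basisMonomials (Fin d) k).constr_basis k
    (fun m => ∏ i, (X i ^ (m i % p) * (X i ^ p - L i) ^ (m i / p))) m
  rwa [coe_basisMonomials] at this

lemma powSubst_monomial_of_lt {m : Fin d →₀ ℕ} (hm : ∀ i, m i < p) :
    powSubst p L (monomial m 1) = monomial m 1 := by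
  rw [powSubst_monomial, monomial_eq, map_one, one_mul, Finsupp.prod_fintype _ _ (by simp)]
  refine Finset.prod_congr rfl fun i _ => ?_
  rw [Nat.mod_eq_of_lt (hm i), Nat.div_eq_of_lt (hm i), pow_zero, mul_one]

lemma linearMap_ext_monomial {V : Type*} [AddCommGroup V] [Module k V]
    {F G : MvPolynomial (Fin d) k →ₗ[k] V} (hFG : ∀ m, F (monomial m 1) = G (monomial m 1)) :
    F = G :=
  (basisMonomials (Fin d) k).ext fun m => by simpa using hFG m

variable {p}

/-- Hence `powSubst` carries the ideal generated by the `X_i ^ p` into the one generated by the `X_i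
^ p - L_i`, although it is only linear. -/
lemma powSubst_X_pow_mul (hp : 0 < p) (i : Fin d) (f : MvPolynomial (Fin d) k) :
    powSubst p L (X i ^ p * f) = (X i ^ p - L i) * powSubst p L f := by
  have : powSubst p L ∘ₗ LinearMap.mulLeft k (X i ^ p) =
      LinearMap.mulLeft k (X i ^ p - L i) ∘ₗ powSubst p L := by
    refine linearMap_ext_monomial fun m => ?_
    simp only [LinearMap.comp_apply, LinearMap.mulLeft_apply]
    rw [X_pow_eq_monomial, monomial_mul, one_mul, powSubst_monomial, powSubst_monomial,
      ← Finset.mul_prod_erase _ _ (Finset.mem_univ i),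
      ← Finset.mul_prod_erase Finset.univ (fun j => X j ^ (m j % p) * (X j ^ p - L j) ^ (m j / p))
        (Finset.mem_univ i), ← X_pow_eq_monomial]
    have h1 : ∏ j ∈ Finset.univ.erase i, (X j ^ ((Finsupp.single i p + m) j % p) *
        (X j ^ p - L j) ^ ((Finsupp.single i p + m) j / p)) =
        ∏ j ∈ Finset.univ.erase i, (X j ^ (m j % p) * (X j ^ p - L j) ^ (m j / p)) := by
      refine Finset.prod_congr rfl fun j hj => ?_
      simp [(Finset.ne_of_mem_erase hj).symm]
    rw [h1]
    simp [Nat.add_div_left _ hp, pow_succ]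
    ring
  exact congrArg (fun F => F f) this

variable {L}

/-- Each `L_i` has degree below `p`, so the substitution keeps the top-degree component: `powSubst`
is unitriangular for the degree filtration, hence bijective. -/
lemma powSubst_sub_mem (hL : ∀ i, L i ∈ degLT k d p) {n : ℕ} {f : MvPolynomial (Fin d) k} (hf : f ∈ degLT k d (n + 1)) :
    powSubst p L f - f ∈ degLT k d n := by
  have hmon : ∀ m : Fin d →₀ ℕ, powSubst p L (monomial m 1) - monomial m 1 ∈
      degLT k d m.degree := by
    intro m
    have hX : ∀ (i : Fin d) (n : ℕ), (X i ^ n : MvPolynomial (Fin d) k) ∈ degLT k d (n + 1) :=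
      fun i n => mem_degLT_of_totalDegree_lt (by simp [totalDegree_X_pow])
    have h1 : SameTop (∑ i, (m i % p + p * (m i / p)))
        (∏ i, (X i ^ (m i % p) * (X i ^ p - L i) ^ (m i / p)))
        (∏ i, (X i ^ (m i % p) * (X i ^ p) ^ (m i / p))) := by
      refine SameTop.prod _ fun i => SameTop.mul (SameTop.refl (hX i _)) (SameTop.pow ?_ _)
      exact ⟨sub_mem (hX i p) (degLT_mono (Nat.le_succ p) (hL i)), hX i p, by
        simpa using neg_mem (hL i)⟩
    have h2 : ∑ i, (m i % p + p * (m i / p)) = m.degree := by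
      rw [Finsupp.degree_eq_sum]
      exact Finset.sum_congr rfl fun i _ => Nat.mod_add_div _ _
    have h3 : ∏ i, (X i ^ (m i % p) * (X i ^ p) ^ (m i / p)) = monomial m (1 : k) := by
      rw [monomial_eq, map_one, one_mul, Finsupp.prod_fintype _ _ (by simp)]
      refine Finset.prod_congr rfl fun i _ => ?_
      rw [← pow_mul, ← pow_add, Nat.mod_add_div]
    rw [h2, h3, ← powSubst_monomial] at h1
    exact h1.2.2
  have hsum : powSubst p L f - f =
      ∑ m ∈ f.support, f.coeff m • (powSubst p L (monomial m 1) - monomial m 1) := by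
    have : f = ∑ m ∈ f.support, f.coeff m • monomial m (1 : k) := by
      conv_lhs => rw [f.as_sum]
      simp [smul_monomial]
    conv_lhs => rw [this]
    simp only [map_sum, map_smul, smul_sub, Finset.sum_sub_distrib]
  rw [hsum]
  refine sum_mem fun m hm => Submodule.smul_mem _ _ (degLT_mono ?_ (hmon m))
  exact Nat.lt_succ_iff.1 (mem_degLT.1 hf m hm)

lemma powSubst_injective (hL : ∀ i, L i ∈ degLT k d p) : Function.Injective (powSubst p L) := by
  rw [← LinearMap.ker_eq_bot, LinearMap.ker_eq_bot']
  intro f hf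
  obtain ⟨n, hn⟩ := exists_mem_degLT f
  induction n with
  | zero => exact eq_zero_of_mem_degLT_zero hn
  | succ n ih =>
    apply ih
    have := powSubst_sub_mem hL hn
    rw [hf, zero_sub] at this
    simpa using neg_mem this

lemma powSubst_surjective (hL : ∀ i, L i ∈ degLT k d p) : Function.Surjective (powSubst p L) := by
  intro f
  obtain ⟨n, hn⟩ := exists_mem_degLT f
  induction n generalizing f with
  | zero => exact ⟨0, by rw [eq_zero_of_mem_degLT_zero hn, map_zero]⟩
  | succ n ih =>
    obtain ⟨g, hg⟩ := ih (powSubst p L f - f) (powSubst_sub_mem hL hn)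
    exact ⟨f - g, by rw [map_sub, hg, sub_sub_cancel]⟩

variable (p L) in
/-- The ideal generated by the polynomials `X_i ^ p - L_i`. -/
def powIdeal : Ideal (MvPolynomial (Fin d) k) := Ideal.span (Set.range fun i => X i ^ p - L i)

lemma exists_eq_X_pow_mul {m : Fin d →₀ ℕ} {i : Fin d} (hi : p ≤ m i) :
    ∃ f, monomial m (1 : k) = X i ^ p * f := by
  refine ⟨monomial (m - Finsupp.single i p) 1, ?_⟩
  rw [X_pow_eq_monomial, monomial_mul, one_mul, add_tsub_cancel_of_le]
  exact Finsupp.single_le_iff.2 hi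

/-- A monomial with exponents less than `p` has a coefficient functional that vanishes on the
ideal generated by the polynomials `X_i ^ p - L_i`. -/
lemma exists_coeff_functional (hp : 0 < p) (hL : ∀ i, L i ∈ degLT k d p)
    (s : Fin d →₀ ℕ) (hs : ∀ i, s i < p) :
    ∃ F : MvPolynomial (Fin d) k →ₗ[k] k, (∀ f ∈ powIdeal p L, F f = 0) ∧
      ∀ t : Fin d →₀ ℕ, (∀ i, t i < p) → F (monomial t 1) = if t = s then 1 else 0 := by
  -- The functional is the coefficient at `s` after undoing `powSubst`, which fixes the monomials
  -- with small exponents.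
  let E := LinearEquiv.ofBijective (powSubst p L) ⟨powSubst_injective hL, powSubst_surjective hL⟩
  have hE : ∀ f, E.symm (powSubst p L f) = f := fun f => E.symm_apply_apply f
  refine ⟨lcoeff k s ∘ₗ E.symm.toLinearMap, fun f hf => ?_, fun t ht => ?_⟩
  -- Undoing `powSubst` turns each summand into a multiple of `X_i ^ p`, and this has no coefficient
  -- at `s` because `s i < p`.
  · obtain ⟨c, rfl⟩ := (Ideal.mem_span_range_iff_exists_fun).1 hf
    rw [map_sum]
    refine Finset.sum_eq_zero fun i _ => ?_
    obtain ⟨g, hg⟩ := powSubst_surjective hL (c i)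
    rw [← hg, mul_comm, ← powSubst_X_pow_mul L hp, LinearMap.comp_apply, LinearEquiv.coe_coe, hE,
      lcoeff_apply, X_pow_eq_monomial, coeff_monomial_mul', if_neg]
    rw [Finsupp.single_le_iff]
    exact (hs i).not_ge
  · rw [LinearMap.comp_apply, LinearEquiv.coe_coe, ← powSubst_monomial_of_lt p L ht, hE,
      lcoeff_apply, coeff_monomial]

lemma exists_mem_span_sub_mem_powIdeal (hp : 0 < p) (hL : ∀ i, L i ∈ degLT k d p)
    (f : MvPolynomial (Fin d) k) :
    ∃ g ∈ Submodule.span k {g | ∃ t : Fin d →₀ ℕ, (∀ i, t i < p) ∧ g = monomial t (1 : k)},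
      f - g ∈ powIdeal p L := by
  -- For an image under `powSubst`, monomials with small exponents are already reduced and all
  -- others land in the ideal.
  obtain ⟨f, rfl⟩ := powSubst_surjective hL f
  induction f using MvPolynomial.induction_on' with
  | monomial m c =>
    have hm : monomial m c = c • monomial m (1 : k) := by simp [smul_monomial]
    by_cases h : ∀ i, m i < p
    · refine ⟨monomial m c, ?_, ?_⟩
      · rw [hm]
        exact Submodule.smul_mem _ _ (Submodule.subset_span ⟨m, h, rfl⟩)
      · rw [hm, map_smul, powSubst_monomial_of_lt p L h, sub_self]
        exact zero_mem _
    · push Not at h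
      obtain ⟨i, hi⟩ := h
      obtain ⟨g, hg⟩ := exists_eq_X_pow_mul (k := k) hi
      refine ⟨0, zero_mem _, ?_⟩
      rw [hm, map_smul, hg, powSubst_X_pow_mul L hp, sub_zero, smul_eq_C_mul]
      exact Ideal.mul_mem_left _ _ (Ideal.mul_mem_right _ _ (Ideal.subset_span ⟨i, rfl⟩))
  | add a b ha hb =>
    obtain ⟨ga, ha1, ha2⟩ := ha
    obtain ⟨gb, hb1, hb2⟩ := hb
    refine ⟨ga + gb, add_mem ha1 hb1, ?_⟩
    rw [map_add, add_sub_add_comm]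
    exact add_mem ha2 hb2

end PolynomialNormalForm
end ConnHopf

/-! ### The monomial basis of `u(h)` and its coordinate functionals. -/

namespace ConnHopf
namespace RestrictedEnv

noncomputable section LinearForms

variable {k : Type*} [Field k] {p : ℕ} {h : Type*} [AddCommGroup h] [Module k h]
variable {d : ℕ} (x : Module.Basis (Fin d) k h)

/-- The linear form in `k[X₁, …, X_d]` with the coordinates of a vector as its coefficients. -/
def linForm : h →ₗ[k] MvPolynomial (Fin d) k := x.constr k MvPolynomial.X

lemma linForm_basis (i : Fin d) : linForm x (x i) = MvPolynomial.X i := x.constr_basis k _ i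

lemma linForm_mem_degLT (hp : 1 < p) (v : h) : linForm x v ∈ degLT k d p := by
  rw [← x.sum_repr v, map_sum]
  refine sum_mem fun i _ => ?_
  rw [map_smul, linForm_basis]
  exact Submodule.smul_mem _ _ (mem_degLT_of_totalDegree_lt (by simpa using hp))

/-- The exponents less than `p`. -/
def box (p d : ℕ) : Finset (Fin d → ℕ) := Fintype.piFinset fun _ => Finset.range p

lemma mem_box {s : Fin d → ℕ} : s ∈ box p d ↔ ∀ i, s i < p := by simp [box]

lemma mem_box_of_le {s t : Fin d → ℕ} (hst : s ≤ t) (ht : t ∈ box p d) : s ∈ box p d :=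
  mem_box.2 fun i => (hst i).trans_lt (mem_box.1 ht i)

end LinearForms

noncomputable section Coordinates

variable {k : Type*} [Field k] {p : ℕ} [Fact p.Prime] [CharP k p]
variable {h : Type*} [AddCommGroup h] [Module k h] (q : h →ₛₗ[frobenius k p] h)

theorem induction {motive : RestrictedEnv q → Prop}
    (algebraMap : ∀ c, motive (algebraMap k (RestrictedEnv q) c)) (ι : ∀ v, motive (ι q v))
    (mul : ∀ a b, motive a → motive b → motive (a * b))
    (add : ∀ a b, motive a → motive b → motive (a + b)) (a : RestrictedEnv q) : motive a := by
  obtain ⟨b, rfl⟩ : ∃ b, mkHom q b = a := Ideal.Quotient.mk_surjective a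
  induction b using SymmetricAlgebra.induction with
  | algebraMap c => rw [AlgHom.commutes]; exact algebraMap c
  | ι v => exact ι v
  | mul a b ha hb => rw [map_mul]; exact mul _ _ ha hb
  | add a b ha hb => rw [map_add]; exact add _ _ ha hb

variable {d : ℕ} (x : Module.Basis (Fin d) k h)

/-- The relations of `u(h)` in the coordinates given by a basis. -/
abbrev relIdeal : Ideal (MvPolynomial (Fin d) k) := powIdeal p fun i => linForm x (q (x i))

/-- Both sides are additive and Frobenius-semilinear in `v`, so the relations for basis vectors
imply those for all of `h`. -/
lemma mk_linForm_pow (v : h) :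
    (Ideal.Quotient.mkₐ k (relIdeal q x) (linForm x v)) ^ p =
      Ideal.Quotient.mkₐ k (relIdeal q x) (linForm x (q v)) := by
  have hv : v ∈ Submodule.span k (Set.range x) := x.mem_span v
  induction hv using Submodule.span_induction with
  | mem v hv =>
    obtain ⟨i, rfl⟩ := hv
    rw [linForm_basis, ← map_pow, ← sub_eq_zero, ← map_sub]
    exact Ideal.Quotient.eq_zero_iff_mem.2 (Ideal.subset_span ⟨i, rfl⟩)
  | zero => simp [(Fact.out : p.Prime).ne_zero]
  | add v w _ _ hv hw => simp only [map_add, add_pow_p k, hv, hw]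
  | smul c v _ hv => simp only [map_smulₛₗ, RingHom.id_apply, smul_pow, hv, frobenius_def]

/-- The map from `u(h)` to its presentation by polynomials. -/
def toPoly : RestrictedEnv q →ₐ[k] MvPolynomial (Fin d) k ⧸ relIdeal q x :=
  lift q ((Ideal.Quotient.mkₐ k (relIdeal q x)).toLinearMap ∘ₗ linForm x) (fun v => by
    rw [LinearMap.comp_apply, LinearMap.comp_apply]
    exact mk_linForm_pow q x v)

lemma toPoly_ι (i : Fin d) :
    toPoly q x (ι q (x i)) = Ideal.Quotient.mkₐ k (relIdeal q x) (MvPolynomial.X i) := by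
  rw [toPoly, lift_ι, LinearMap.comp_apply, linForm_basis]
  rfl

/-- The evaluation of polynomials at the elements of a basis. -/
def evalBasis : MvPolynomial (Fin d) k →ₐ[k] RestrictedEnv q :=
  MvPolynomial.aeval fun i => ι q (x i)

lemma evalBasis_linForm (v : h) : evalBasis q x (linForm x v) = ι q v := by
  have : (evalBasis q x).toLinearMap ∘ₗ linForm x = ι q :=
    x.ext fun i => by simp [linForm_basis, evalBasis]
  exact congrArg (fun F => F v) this

lemma evalBasis_surjective : Function.Surjective (evalBasis q x) := by
  intro a
  induction a using induction with
  | algebraMap c => exact ⟨_, (evalBasis q x).commutes c⟩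
  | ι v => exact ⟨_, evalBasis_linForm q x v⟩
  | mul a b ha hb =>
    obtain ⟨f, rfl⟩ := ha
    obtain ⟨g, rfl⟩ := hb
    exact ⟨f * g, map_mul _ _ _⟩
  | add a b ha hb =>
    obtain ⟨f, rfl⟩ := ha
    obtain ⟨g, rfl⟩ := hb
    exact ⟨f + g, map_add _ _ _⟩

lemma evalBasis_eq_zero {f : MvPolynomial (Fin d) k} (hf : f ∈ relIdeal q x) :
    evalBasis q x f = 0 := by
  have : relIdeal q x ≤ RingHom.ker (evalBasis q x) := by
    refine Ideal.span_le.2 ?_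
    rintro _ ⟨i, rfl⟩
    have hX : evalBasis q x (MvPolynomial.X i) = ι q (x i) := by simp [evalBasis]
    rw [SetLike.mem_coe, RingHom.mem_ker, map_sub, map_pow, hX, evalBasis_linForm, ι_pow, sub_self]
  exact this hf

/-- The divided power monomial `∏ x_i ^ s_i / s_i!`. -/
def divMon (s : Fin d → ℕ) : RestrictedEnv q :=
  ∏ i, (((s i).factorial : k)⁻¹ • ι q (x i) ^ s i)

lemma factorial_ne_zero {n : ℕ} (hn : n < p) : (n.factorial : k) ≠ 0 := by
  rw [Ne, CharP.cast_eq_zero_iff k p, (Fact.out : p.Prime).dvd_factorial]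
  exact hn.not_ge

lemma divMon_eq_smul (s : Fin d → ℕ) :
    divMon q x s = (∏ i, ((s i).factorial : k)⁻¹) • ∏ i, ι q (x i) ^ s i := by
  rw [divMon, Finset.prod_smul]

lemma prod_pow_eq_smul_divMon {s : Fin d → ℕ} (hs : s ∈ box p d) :
    ∏ i, ι q (x i) ^ s i = (∏ i, ((s i).factorial : k)) • divMon q x s := by
  have h1 : ∏ i, ((s i).factorial : k) * ((s i).factorial : k)⁻¹ = 1 :=
    Finset.prod_eq_one fun i _ => mul_inv_cancel₀ (factorial_ne_zero (mem_box.1 hs i))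
  rw [divMon_eq_smul, smul_smul, ← Finset.prod_mul_distrib, h1, one_smul]

lemma monomial_eq_prod (s : Fin d →₀ ℕ) :
    MvPolynomial.monomial s (1 : k) = ∏ i, MvPolynomial.X i ^ s i := by
  rw [MvPolynomial.monomial_eq, map_one, one_mul, Finsupp.prod_fintype _ _ (by simp)]

/-- This is the linear independence half of the Poincaré–Birkhoff–Witt theorem for `u(h)`; the
spanning half is `span_divMon`. -/
lemma exists_dual (s : Fin d → ℕ) : ∃ F : RestrictedEnv q →ₗ[k] k, ∀ t ∈ box p d,
    F (divMon q x t) = if t = s then 1 else 0 := by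
  by_cases hs : s ∈ box p d
  · have hp : p.Prime := Fact.out
    obtain ⟨F, hF1, hF2⟩ := exists_coeff_functional hp.pos
      (fun i => linForm_mem_degLT x hp.one_lt (q (x i))) (Finsupp.equivFunOnFinite.symm s)
      (mem_box.1 hs)
    let G : (MvPolynomial (Fin d) k ⧸ relIdeal q x) →ₗ[k] k :=
      ((relIdeal q x).restrictScalars k).liftQ F hF1 ∘ₗ
        (Submodule.Quotient.restrictScalarsEquiv k (relIdeal q x)).symm.toLinearMap
    have hG : ∀ f, G (Ideal.Quotient.mkₐ k (relIdeal q x) f) = F f := fun f => rfl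
    -- The factor converts a coefficient of the plain monomial into one of the divided power.
    refine ⟨(∏ i, ((s i).factorial : k)) • (G ∘ₗ (toPoly q x).toLinearMap), fun t ht => ?_⟩
    have h1 : toPoly q x (∏ i, ι q (x i) ^ t i) = Ideal.Quotient.mkₐ k (relIdeal q x)
        (MvPolynomial.monomial (Finsupp.equivFunOnFinite.symm t) 1) := by
      rw [monomial_eq_prod, map_prod, map_prod]
      exact Finset.prod_congr rfl fun i _ => by rw [map_pow, toPoly_ι, map_pow]; rfl
    rw [divMon_eq_smul, map_smul, LinearMap.smul_apply, LinearMap.comp_apply,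
      AlgHom.toLinearMap_apply, h1, hG, hF2 _ (mem_box.1 ht)]
    simp only [EmbeddingLike.apply_eq_iff_eq]
    split_ifs with hts
    · subst hts
      rw [smul_eq_mul, smul_eq_mul, mul_one, ← Finset.prod_mul_distrib]
      exact Finset.prod_eq_one fun i _ => inv_mul_cancel₀ (factorial_ne_zero (mem_box.1 ht i))
    · simp
  · refine ⟨0, fun t ht => ?_⟩
    rw [if_neg, LinearMap.zero_apply]
    rintro rfl
    exact hs ht

/-- The linear functionals dual to the divided power monomials. -/
def coord (s : Fin d → ℕ) : RestrictedEnv q →ₗ[k] k :=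
  -- The value `0` outside the box lets the coordinate formulas below hold for all exponents,
  -- including sums `s + t` that leave the box.
  if s ∈ box p d then (exists_dual q x s).choose else 0

lemma coord_eq_zero {s : Fin d → ℕ} (hs : s ∉ box p d) : coord q x s = 0 := by
  rw [coord, if_neg hs]

lemma coord_divMon (s : Fin d → ℕ) {t : Fin d → ℕ} (ht : t ∈ box p d) :
    coord q x s (divMon q x t) = if t = s then 1 else 0 := by
  by_cases hs : s ∈ box p d
  · rw [coord, if_pos hs]
    exact (exists_dual q x s).choose_spec t ht
  · rw [coord_eq_zero q x hs, if_neg, LinearMap.zero_apply]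
    rintro rfl
    exact hs ht

lemma span_divMon :
    Submodule.span k (divMon q x '' (box p d : Set (Fin d → ℕ))) = ⊤ := by
  rw [eq_top_iff]
  intro a _
  obtain ⟨f, rfl⟩ := evalBasis_surjective q x a
  have hp : p.Prime := Fact.out
  obtain ⟨g, hg, hfg⟩ := exists_mem_span_sub_mem_powIdeal hp.pos
      (fun i => linForm_mem_degLT x hp.one_lt (q (x i))) f
  have h0 := evalBasis_eq_zero q x hfg
  rw [map_sub, sub_eq_zero] at h0
  rw [h0]
  clear h0 hfg
  induction hg using Submodule.span_induction with
  | mem g hg =>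
    obtain ⟨t, ht, rfl⟩ := hg
    have htb : (t : Fin d → ℕ) ∈ box p d := mem_box.2 ht
    have h1 : evalBasis q x (MvPolynomial.monomial t 1) = ∏ i, ι q (x i) ^ t i := by
      rw [monomial_eq_prod, map_prod]
      exact Finset.prod_congr rfl fun i _ => by simp [evalBasis]
    rw [h1, prod_pow_eq_smul_divMon q x htb]
    exact Submodule.smul_mem _ _ (Submodule.subset_span ⟨_, htb, rfl⟩)
  | zero => rw [map_zero]; exact zero_mem _
  | add a b _ _ ha hb => rw [map_add]; exact add_mem ha hb
  | smul c a _ ha => rw [map_smul]; exact Submodule.smul_mem _ _ ha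

lemma sum_coord (a : RestrictedEnv q) : ∑ s ∈ box p d, coord q x s a • divMon q x s = a := by
  have ha : a ∈ Submodule.span k (divMon q x '' (box p d : Set (Fin d → ℕ))) := by
    rw [span_divMon]; trivial
  induction ha using Submodule.span_induction with
  | mem a ha =>
    obtain ⟨t, ht, rfl⟩ := ha
    rw [Finset.sum_eq_single t]
    · rw [coord_divMon q x t ht, if_pos rfl, one_smul]
    · intro s _ hst
      rw [coord_divMon q x s ht, if_neg hst.symm, zero_smul]
    · exact fun h => absurd ht h
  | zero => simp
  | add a b _ _ ha hb => simp only [map_add, add_smul, Finset.sum_add_distrib, ha, hb]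
  | smul c a _ ha => simp only [map_smul, smul_assoc, ← Finset.smul_sum, ha]

end Coordinates

end RestrictedEnv
end ConnHopf

/-! ### The comultiplication and the cobar differentials in coordinates. -/

namespace ConnHopf
namespace RestrictedEnv

noncomputable section Coalgebra

variable {k : Type*} [Field k] {p : ℕ} [Fact p.Prime] [CharP k p]
variable {h : Type*} [AddCommGroup h] [Module k h] (q : h →ₛₗ[frobenius k p] h)
variable {d : ℕ} (x : Module.Basis (Fin d) k h)

lemma zero_mem_box : (0 : Fin d → ℕ) ∈ box p d := mem_box.2 fun _ => (Fact.out : p.Prime).pos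

lemma divMon_zero : divMon q x 0 = 1 := by simp [divMon]

lemma coord_one (s : Fin d → ℕ) : coord q x s 1 = if 0 = s then 1 else 0 := by
  rw [← divMon_zero q x, coord_divMon q x s zero_mem_box]

lemma linearMap_ext_divMon {V : Type*} [AddCommGroup V] [Module k V]
    {F G : RestrictedEnv q →ₗ[k] V} (hFG : ∀ t ∈ box p d, F (divMon q x t) = G (divMon q x t)) :
    F = G := by
  refine LinearMap.ext_on (span_divMon q x) ?_
  rintro _ ⟨t, ht, rfl⟩
  exact hFG t ht

lemma coord_zero_eq_counit (a : RestrictedEnv q) : coord q x 0 a = counit q a := by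
  have : coord q x 0 = (counit q).toLinearMap := by
    refine linearMap_ext_divMon q x fun t ht => ?_
    rw [coord_divMon q x 0 ht, AlgHom.toLinearMap_apply, divMon, map_prod]
    simp only [map_smul, map_pow, counit_ι, smul_eq_mul]
    split_ifs with h0
    · subst h0; simp
    · obtain ⟨i, hi⟩ := Function.ne_iff.1 h0
      rw [Finset.prod_eq_zero (Finset.mem_univ i)]
      rw [zero_pow hi, mul_zero]
  exact congrArg (fun F => F a) this

lemma mem_aug {a : RestrictedEnv q} : a ∈ aug q ↔ coord q x 0 a = 0 := by
  rw [coord_zero_eq_counit]; rfl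

/-- The contraction of the first tensor factor with a coordinate functional. -/
def contract (W : Type*) [AddCommGroup W] [Module k W] (s : Fin d → ℕ) :
    RestrictedEnv q ⊗[k] W →ₗ[k] W :=
  (TensorProduct.lid k W).toLinearMap ∘ₗ LinearMap.rTensor W (coord q x s)

variable {W : Type*} [AddCommGroup W] [Module k W]

@[simp]
lemma contract_tmul (s : Fin d → ℕ) (a : RestrictedEnv q) (w : W) :
    contract q x W s (a ⊗ₜ w) = coord q x s a • w := by
  simp [contract]

lemma sum_divMon_tmul_contract (u : RestrictedEnv q ⊗[k] W) :
    ∑ s ∈ box p d, divMon q x s ⊗ₜ[k] contract q x W s u = u := by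
  induction u using TensorProduct.induction_on with
  | zero => simp
  | tmul a w =>
    simp only [contract_tmul, ← TensorProduct.smul_tmul, ← TensorProduct.sum_tmul]
    rw [sum_coord]
  | add u v hu hv => simp only [map_add, TensorProduct.tmul_add, Finset.sum_add_distrib, hu, hv]

lemma ext_contract {u v : RestrictedEnv q ⊗[k] W}
    (huv : ∀ s, contract q x W s u = contract q x W s v) : u = v := by
  rw [← sum_divMon_tmul_contract q x u, ← sum_divMon_tmul_contract q x v]
  simp only [huv]

lemma ext_coord {a b : RestrictedEnv q} (hab : ∀ s, coord q x s a = coord q x s b) : a = b := by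
  rw [← sum_coord q x a, ← sum_coord q x b]
  simp only [hab]

/-- The coordinate functionals on `A ⊗ A`. -/
def coord2 (s t : Fin d → ℕ) : RestrictedEnv q ⊗[k] RestrictedEnv q →ₗ[k] k :=
  coord q x t ∘ₗ contract q x _ s

@[simp]
lemma coord2_tmul (s t : Fin d → ℕ) (a b : RestrictedEnv q) :
    coord2 q x s t (a ⊗ₜ b) = coord q x s a * coord q x t b := by
  simp [coord2]

lemma ext_coord2 {u v : RestrictedEnv q ⊗[k] RestrictedEnv q}
    (huv : ∀ s t, coord2 q x s t u = coord2 q x s t v) : u = v :=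
  ext_contract q x fun s => ext_coord q x fun t => huv s t

lemma coord2_eq_zero_left {s : Fin d → ℕ} (hs : s ∉ box p d) (t : Fin d → ℕ) :
    coord2 q x s t = 0 :=
  TensorProduct.ext' fun a b => by simp [coord_eq_zero q x hs]

/-- The coordinate functionals on `A ⊗ A ⊗ A`. -/
def coord3 (r s t : Fin d → ℕ) :
    RestrictedEnv q ⊗[k] (RestrictedEnv q ⊗[k] RestrictedEnv q) →ₗ[k] k :=
  coord2 q x s t ∘ₗ contract q x _ r

@[simp]
lemma coord3_tmul (r s t : Fin d → ℕ) (a : RestrictedEnv q)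
    (u : RestrictedEnv q ⊗[k] RestrictedEnv q) :
    coord3 q x r s t (a ⊗ₜ u) = coord q x r a * coord2 q x s t u := by
  simp [coord3]

lemma ext_coord3 {u v : RestrictedEnv q ⊗[k] (RestrictedEnv q ⊗[k] RestrictedEnv q)}
    (huv : ∀ r s t, coord3 q x r s t u = coord3 q x r s t v) : u = v :=
  ext_contract q x fun r => ext_coord2 q x fun s t => huv r s t

lemma coord3_assoc_tmul (r s t : Fin d → ℕ) (u : RestrictedEnv q ⊗[k] RestrictedEnv q)
    (b : RestrictedEnv q) :
    coord3 q x r s t (TensorProduct.assoc k _ _ _ (u ⊗ₜ[k] b)) =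
      coord2 q x r s u * coord q x t b := by
  induction u using TensorProduct.induction_on with
  | zero => simp
  | tmul a c => simp [mul_assoc]
  | add u v hu hv => simp only [TensorProduct.add_tmul, map_add, hu, hv, add_mul]

/-- The factorials absorb the binomial coefficients; they are invertible because `n < p`. -/
lemma comul_divPow {n : ℕ} (hn : n < p) (v : h) :
    comul q (((n.factorial : k)⁻¹) • ι q v ^ n) =
      ∑ m ∈ Finset.HasAntidiagonal.antidiagonal n, ((m.1.factorial : k)⁻¹ • ι q v ^ m.1) ⊗ₜ[k]
        ((m.2.factorial : k)⁻¹ • ι q v ^ m.2) := by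
  rw [map_smul, map_pow, comul_ι, (Commute.all _ _).add_pow', Finset.smul_sum]
  refine Finset.sum_congr rfl fun m hm => ?_
  rw [Finset.HasAntidiagonal.mem_antidiagonal] at hm
  subst hm
  rw [Algebra.TensorProduct.tmul_pow, Algebra.TensorProduct.tmul_pow,
    Algebra.TensorProduct.tmul_mul_tmul, one_pow, one_pow, one_mul, mul_one,
    TensorProduct.smul_tmul_smul, ← Nat.cast_smul_eq_nsmul k, smul_smul]
  congr 1
  have h1 : (m.1.factorial : k) ≠ 0 := factorial_ne_zero (p := p) (by omega)
  have h2 : (m.2.factorial : k) ≠ 0 := factorial_ne_zero (p := p) (by omega)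
  have h3 : ((m.1 + m.2).factorial : k) ≠ 0 := factorial_ne_zero (p := p) hn
  have h4 : (((m.1 + m.2).choose m.1 : ℕ) : k) * m.1.factorial * m.2.factorial =
      (m.1 + m.2).factorial := by
    rw [Nat.choose_symm_add, ← Nat.add_choose_mul_factorial_mul_factorial m.1 m.2]
    push_cast
    ring
  field_simp
  rw [← h4]

lemma prod_tmul {ι R S : Type*} [CommRing R] [Algebra k R] [CommRing S] [Algebra k S]
    (s : Finset ι) (a : ι → R) (b : ι → S) :
    ∏ i ∈ s, a i ⊗ₜ[k] b i = (∏ i ∈ s, a i) ⊗ₜ[k] (∏ i ∈ s, b i) := by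
  classical
  induction s using Finset.induction_on with
  | empty => simp [Algebra.TensorProduct.one_def]
  | insert j s hj ih =>
    rw [Finset.prod_insert hj, Finset.prod_insert hj, Finset.prod_insert hj, ih,
      Algebra.TensorProduct.tmul_mul_tmul]

lemma comul_divMon {t : Fin d → ℕ} (ht : t ∈ box p d) :
    comul q (divMon q x t) =
      ∑ f ∈ Fintype.piFinset fun i => Finset.HasAntidiagonal.antidiagonal (t i),
        divMon q x (fun i => (f i).1) ⊗ₜ[k] divMon q x (fun i => (f i).2) := by
  rw [divMon, map_prod]
  simp only [comul_divPow q (mem_box.1 ht _)]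
  rw [Finset.prod_univ_sum]
  exact Finset.sum_congr rfl fun f _ => prod_tmul _ _ _

/-- The comultiplication is dual to the addition of exponents. -/
lemma coord2_comul (s t : Fin d → ℕ) (a : RestrictedEnv q) :
    coord2 q x s t (comul q a) = coord q x (s + t) a := by
  have : coord2 q x s t ∘ₗ (comul q).toLinearMap = coord q x (s + t) := by
    refine linearMap_ext_divMon q x fun r hr => ?_
    rw [LinearMap.comp_apply, AlgHom.toLinearMap_apply, comul_divMon q x hr, map_sum,
      coord_divMon q x _ hr]
    -- Only the splitting of `r` into `s` and `t` contributes, and it occurs exactly when `r = s +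
    -- t`.
    have hterm : ∀ f ∈ Fintype.piFinset fun i => Finset.HasAntidiagonal.antidiagonal (r i),
        coord2 q x s t (divMon q x (fun i => (f i).1) ⊗ₜ[k] divMon q x (fun i => (f i).2)) =
          if f = fun i => (s i, t i) then 1 else 0 := by
      intro f hf
      have hf' : ∀ i, (f i).1 + (f i).2 = r i := by simpa using hf
      rw [coord2_tmul,
        coord_divMon q x s (mem_box_of_le (fun i => by have := hf' i; dsimp; omega) hr),
        coord_divMon q x t (mem_box_of_le (fun i => by have := hf' i; dsimp; omega) hr)]
      by_cases hfst : f = fun i => (s i, t i)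
      · subst hfst; simp
      · rw [if_neg hfst]
        by_cases h1 : (fun i => (f i).1) = s
        · rw [if_pos h1, if_neg, mul_zero]
          rintro rfl
          exact hfst (by subst h1; rfl)
        · rw [if_neg h1, zero_mul]
    rw [Finset.sum_congr rfl hterm, Finset.sum_ite_eq']
    refine if_congr ?_ rfl rfl
    simp [funext_iff, eq_comm]
  exact congrArg (fun F => F a) this

lemma coord2_redComul {a : RestrictedEnv q} (ha : a ∈ aug q) (s t : Fin d → ℕ) :
    coord2 q x s t (redComul q a) = if s = 0 ∨ t = 0 then 0 else coord q x (s + t) a := by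
  have h1 : redComul q a = comul q a - a ⊗ₜ 1 - 1 ⊗ₜ a := rfl
  rw [mem_aug q x] at ha
  rw [h1, map_sub, map_sub, coord2_comul, coord2_tmul, coord2_tmul, coord_one, coord_one]
  by_cases hs : s = 0
  · subst hs
    by_cases ht : t = 0
    · subst ht; simp [ha]
    · simp [ha, Ne.symm ht]
  · by_cases ht : t = 0
    · subst ht; simp [Ne.symm hs]
    · simp [Ne.symm hs, Ne.symm ht, hs, ht]

lemma linearMap_eq_of_mem_aug2 {V : Type*} [AddCommGroup V] [Module k V]
    {F G : RestrictedEnv q ⊗[k] RestrictedEnv q →ₗ[k] V}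
    (hFG : ∀ a ∈ aug q, ∀ b ∈ aug q, F (a ⊗ₜ b) = G (a ⊗ₜ b))
    {u : RestrictedEnv q ⊗[k] RestrictedEnv q} (hu : u ∈ aug2 q) : F u = G u := by
  obtain ⟨w, rfl⟩ := hu
  induction w using TensorProduct.induction_on with
  | zero => simp
  | tmul a b => exact hFG a a.2 b b.2
  | add a b ha hb => rw [map_add, map_add, map_add, ha, hb]

lemma tmul_mem_aug2 {a b : RestrictedEnv q} (ha : a ∈ aug q) (hb : b ∈ aug q) :
    a ⊗ₜ[k] b ∈ aug2 q := ⟨(⟨a, ha⟩ : aug q) ⊗ₜ (⟨b, hb⟩ : aug q), rfl⟩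

lemma coord2_zero_left {u : RestrictedEnv q ⊗[k] RestrictedEnv q} (hu : u ∈ aug2 q)
    (t : Fin d → ℕ) : coord2 q x 0 t u = 0 :=
  linearMap_eq_of_mem_aug2 q (G := 0) (fun a ha b _ => by
    rw [coord2_tmul, (mem_aug q x).1 ha, zero_mul, LinearMap.zero_apply]) hu

lemma coord2_zero_right {u : RestrictedEnv q ⊗[k] RestrictedEnv q} (hu : u ∈ aug2 q)
    (s : Fin d → ℕ) : coord2 q x s 0 u = 0 :=
  linearMap_eq_of_mem_aug2 q (G := 0) (fun a _ b hb => by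
    rw [coord2_tmul, (mem_aug q x).1 hb, mul_zero, LinearMap.zero_apply]) hu

lemma coord3_d2 {u : RestrictedEnv q ⊗[k] RestrictedEnv q} (hu : u ∈ aug2 q)
    (r s t : Fin d → ℕ) : coord3 q x r s t (d2 q u) =
      if r = 0 ∨ s = 0 ∨ t = 0 then 0
      else coord2 q x r (s + t) u - coord2 q x (r + s) t u := by
  have key : ∀ a ∈ aug q, ∀ b ∈ aug q, coord3 q x r s t (d2 q (a ⊗ₜ b)) =
      -(coord2 q x r s (redComul q a) * coord q x t b) +
        coord q x r a * coord2 q x s t (redComul q b) := by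
    intro a _ b _
    have : d2 q (a ⊗ₜ b) = -(TensorProduct.assoc k _ _ _ (redComul q a ⊗ₜ[k] b)) +
      a ⊗ₜ redComul q b := rfl
    rw [this, map_add, map_neg, coord3_assoc_tmul, coord3_tmul]
  split_ifs with hz
  · refine linearMap_eq_of_mem_aug2 q (F := coord3 q x r s t ∘ₗ d2 q) (G := 0)
      (fun a ha b hb => ?_) hu
    rw [LinearMap.comp_apply, key a ha b hb, coord2_redComul q x ha, coord2_redComul q x hb]
    have h1 := (mem_aug q x).1 ha
    have h2 := (mem_aug q x).1 hb
    rcases hz with rfl | rfl | rfl <;> simp [h1, h2]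
  · refine linearMap_eq_of_mem_aug2 q (F := coord3 q x r s t ∘ₗ d2 q)
      (G := coord2 q x r (s + t) - coord2 q x (r + s) t) (fun a ha b hb => ?_) hu
    rw [LinearMap.comp_apply, key a ha b hb, coord2_redComul q x ha, coord2_redComul q x hb]
    push Not at hz
    simp [hz.1, hz.2.1, hz.2.2]
    ring

/-- The cocycle condition becomes the balancing identity to which `exists_of_balanced` applies. -/
lemma mem_Z2_iff {u : RestrictedEnv q ⊗[k] RestrictedEnv q} (hu : u ∈ aug2 q) :
    u ∈ Z2 q ↔ ∀ r s t : Fin d → ℕ, r ≠ 0 → s ≠ 0 → t ≠ 0 →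
      coord2 q x r (s + t) u = coord2 q x (r + s) t u := by
  constructor
  · intro h r s t hr hs ht
    have h0 : d2 q u = 0 := h.2
    have := coord3_d2 q x hu r s t
    rw [h0, map_zero, if_neg (by simp [hr, hs, ht]), eq_comm, sub_eq_zero] at this
    exact this
  · intro h
    refine ⟨hu, ext_coord3 q x (v := 0) fun r s t => ?_⟩
    rw [coord3_d2 q x hu, map_zero]
    split_ifs with hz
    · rfl
    · push Not at hz
      rw [h r s t hz.1 hz.2.1 hz.2.2, sub_self]

/-- In the multinomial theorem the denominators `∏ s_i!` are exactly the normalization of the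
divided powers, so only `n!` survives. -/
lemma coord_pow {n : ℕ} (hn : n < p) (c : Fin d → k) (s : Fin d → ℕ) :
    coord q x s (ι q (∑ i, c i • x i) ^ n) =
      if ∑ i, s i = n then (n.factorial : k) * ∏ i, c i ^ s i else 0 := by
  have hpow : ι q (∑ i, c i • x i) ^ n = ∑ f ∈ Finset.piAntidiag Finset.univ n,
      ((n.factorial : k) * ∏ i, c i ^ f i) • divMon q x f := by
    rw [map_sum, Finset.sum_pow_eq_sum_piAntidiag]
    refine Finset.sum_congr rfl fun f hf => ?_
    have hf' : ∑ i, f i = n := (Finset.mem_piAntidiag.1 hf).1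
    have hfb : f ∈ box p d := mem_box.2 fun i =>
      (Finset.single_le_sum (fun j _ => Nat.zero_le (f j)) (Finset.mem_univ i)).trans_lt
        (hf'.trans_lt hn)
    simp only [map_smul, smul_pow, Finset.prod_smul]
    rw [prod_pow_eq_smul_divMon q x hfb, smul_smul, ← nsmul_eq_mul, ← Nat.cast_smul_eq_nsmul k,
      smul_smul, ← hf', ← Nat.multinomial_spec]
    congr 1
    push_cast
    ring
  rw [hpow, map_sum]
  have hterm : ∀ f ∈ Finset.piAntidiag (Finset.univ : Finset (Fin d)) n,
      coord q x s (((n.factorial : k) * ∏ i, c i ^ f i) • divMon q x f) =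
        if f = s then (n.factorial : k) * ∏ i, c i ^ f i else 0 := by
    intro f hf
    have hf' : ∑ i, f i = n := (Finset.mem_piAntidiag.1 hf).1
    have hfb : f ∈ box p d := mem_box.2 fun i =>
      (Finset.single_le_sum (fun j _ => Nat.zero_le (f j)) (Finset.mem_univ i)).trans_lt
        (hf'.trans_lt hn)
    rw [map_smul, coord_divMon q x s hfb, smul_eq_mul, mul_ite, mul_one, mul_zero]
  rw [Finset.sum_congr rfl hterm, Finset.sum_ite_eq']
  refine if_congr ?_ rfl rfl
  simp

end Coalgebra

end RestrictedEnv
end ConnHopf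

/-! ### Balanced functions of two exponents. -/

namespace ConnHopf

noncomputable section BalancedFunctions

variable {k : Type*} [Field k] {p d : ℕ}

/-- A balanced function of two exponents, supported on exponents less than `p`, is a function of
their sum if it is symmetric on the unit exponents and vanishes on the pairs that correspond to
the `p`-th powers of the variables. -/
lemma exists_of_balanced (hp : 1 < p) {F : (Fin d → ℕ) → (Fin d → ℕ) → k}
    (hF : ∀ r s t, r ≠ 0 → s ≠ 0 → t ≠ 0 → F r (s + t) = F (r + s) t)
    (hbox : ∀ s t, s ∉ RestrictedEnv.box p d → F s t = 0)
    (hsymm : ∀ i j, F (Pi.single i 1) (Pi.single j 1) = F (Pi.single j 1) (Pi.single i 1))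
    (hpow : ∀ i, F (Pi.single i 1) (Pi.single i (p - 1)) = 0) :
    ∃ G : (Fin d → ℕ) → k, (∀ s t, s ≠ 0 → t ≠ 0 → F s t = G (s + t)) ∧
      ∀ s, s ∉ RestrictedEnv.box p d → G s = 0 := by
  have hne : ∀ i : Fin d, (Pi.single i 1 : Fin d → ℕ) ≠ 0 := fun i => by simp
  -- The value `F(e_i, τ)` depends only on `e_i + τ`. For `i ≠ j` one has `τ = e_j + ρ` and `τ' =
  -- e_i + ρ`; both values equal `F(e_i + e_j, ρ)` if `ρ ≠ 0`, and `ρ = 0` is the symmetry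
  -- hypothesis.
  have hwd : ∀ i j τ τ', (Pi.single i 1 + τ : Fin d → ℕ) = Pi.single j 1 + τ' →
      F (Pi.single i 1) τ = F (Pi.single j 1) τ' := by
    intro i j τ τ' h
    by_cases hij : i = j
    · subst hij
      rw [add_left_cancel h]
    · have hj := congrFun h j
      simp only [Pi.add_apply, Pi.single_eq_of_ne (Ne.symm hij), Pi.single_eq_same, zero_add] at hj
      have hτ : τ = Pi.single j 1 + (τ - Pi.single j 1) := by
        rw [add_tsub_cancel_of_le]
        intro l
        by_cases hl : l = j
        · subst hl; simp; omega
        · simp [hl]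
      generalize τ - Pi.single j 1 = ρ at hτ
      subst hτ
      rw [add_left_comm] at h
      rw [← add_left_cancel h]
      by_cases hρ : ρ = 0
      · rw [hρ, add_zero, add_zero, hsymm]
      · rw [hF _ _ _ (hne i) (hne j) hρ, hF _ _ _ (hne j) (hne i) hρ, add_comm]
  classical
  -- The default value is taken only at `σ = 0`, the one exponent from which no `e_i` can be split
  -- off.
  let G : (Fin d → ℕ) → k := fun σ =>
    if h : ∃ (i : Fin d) (τ : Fin d → ℕ), σ = Pi.single i 1 + τ then
      F (Pi.single h.choose 1) h.choose_spec.choose else 0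
  have hG : ∀ i τ, G (Pi.single i 1 + τ) = F (Pi.single i 1) τ := by
    intro i τ
    have h : ∃ (j : Fin d) (τ' : Fin d → ℕ), (Pi.single i 1 + τ) = Pi.single j 1 + τ' :=
      ⟨i, τ, rfl⟩
    simp only [G, dif_pos h]
    exact (hwd _ _ _ _ h.choose_spec.choose_spec).symm
  refine ⟨G, fun s t hs ht => ?_, fun s hs => ?_⟩
  · obtain ⟨i, hi⟩ := Function.ne_iff.1 hs
    have hs' : s = Pi.single i 1 + (s - Pi.single i 1) := by
      rw [add_tsub_cancel_of_le]
      intro l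
      by_cases hl : l = i
      · subst hl; simp at hi ⊢; omega
      · simp [hl]
    generalize s - Pi.single i 1 = ρ at hs'
    subst hs'
    rw [add_assoc, hG]
    by_cases hρ : ρ = 0
    · rw [hρ, add_zero, zero_add]
    · exact (hF _ _ _ (hne i) hρ ht).symm
  · rw [RestrictedEnv.mem_box] at hs
    push Not at hs
    obtain ⟨l, hl⟩ := hs
    have hs' : s = Pi.single l p + (s - Pi.single l p) := by
      rw [add_tsub_cancel_of_le]
      intro m
      by_cases hm : m = l
      · subst hm; simpa using hl
      · simp [hm]
    generalize s - Pi.single l p = γ at hs'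
    -- Splitting `p e_l = e_l + (p - 1) e_l` gives `G(p e_l + γ) = F(e_l, (p - 1) e_l + γ)`. This is
    -- `F(p e_l, γ) = 0` if `γ ≠ 0`, and vanishes by `hpow` if `γ = 0`.
    have hsplit : (Pi.single l p : Fin d → ℕ) = Pi.single l 1 + Pi.single l (p - 1) := by
      rw [← Pi.single_add, Nat.add_sub_cancel' hp.le]
    subst hs'
    have hpne : (Pi.single l (p - 1) : Fin d → ℕ) ≠ 0 := by
      rw [Ne, Pi.single_eq_zero_iff]; omega
    rw [hsplit, add_assoc, hG]
    by_cases hγ : γ = 0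
    · rw [hγ, add_zero, hpow]
    · rw [hF _ _ _ (hne l) hpne hγ, ← hsplit]
      apply hbox
      rw [RestrictedEnv.mem_box]
      intro h
      simpa using h l

end BalancedFunctions

/-! ### Cocycles and coboundaries in degrees one and two. -/

namespace RestrictedEnv

noncomputable section Cohomology

variable {k : Type*} [Field k] {p : ℕ} [Fact p.Prime] [CharP k p]
variable {h : Type*} [AddCommGroup h] [Module k h] (q : h →ₛₗ[frobenius k p] h)
variable {d : ℕ} (x : Module.Basis (Fin d) k h)

lemma coord2_d1 {a : RestrictedEnv q} (ha : a ∈ aug q) (s t : Fin d → ℕ) :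
    coord2 q x s t (d1 q a) = if s = 0 ∨ t = 0 then 0 else -coord q x (s + t) a := by
  rw [d1, LinearMap.neg_apply, map_neg, coord2_redComul q x ha]
  split_ifs <;> simp

lemma coord_sum_divMon (G : (Fin d → ℕ) → k) (s : Fin d → ℕ) :
    coord q x s (∑ t ∈ box p d, G t • divMon q x t) = if s ∈ box p d then G s else 0 := by
  rw [map_sum]
  have : ∀ t ∈ box p d, coord q x s (G t • divMon q x t) = if t = s then G t else 0 := by
    intro t ht
    rw [map_smul, coord_divMon q x s ht, smul_eq_mul, mul_ite, mul_one, mul_zero]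
  rw [Finset.sum_congr rfl this, Finset.sum_ite_eq']

lemma mem_B2_of_mem_Z2 {u : RestrictedEnv q ⊗[k] RestrictedEnv q} (hu : u ∈ Z2 q)
    (hsymm : ∀ i j : Fin d, i < j → coord2 q x (Pi.single i 1) (Pi.single j 1) u =
      coord2 q x (Pi.single j 1) (Pi.single i 1) u)
    (hpow : ∀ i : Fin d, coord2 q x (Pi.single i 1) (Pi.single i (p - 1)) u = 0) :
    u ∈ B2 q := by
  obtain ⟨G, hG, hG0⟩ := exists_of_balanced (Fact.out : p.Prime).one_lt
    (F := fun s t => coord2 q x s t u) ((mem_Z2_iff q x hu.1).1 hu)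
    (fun s t hs => by rw [coord2_eq_zero_left q x hs, LinearMap.zero_apply])
    (fun i j => by
      rcases lt_trichotomy i j with hij | rfl | hij
      · exact hsymm i j hij
      · rfl
      · exact (hsymm j i hij).symm) hpow
  -- The sign compensates the one in `d1`, and the zero at exponent `0` puts `a` in the augmentation
  -- ideal.
  let a := ∑ t ∈ box p d, (if t = 0 then 0 else -G t) • divMon q x t
  have ha : ∀ s, coord q x s a = if s ∈ box p d then (if s = 0 then 0 else -G s) else 0 :=
    coord_sum_divMon q x _
  have haug : a ∈ aug q := by
    rw [mem_aug q x, ha]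
    simp
  refine ⟨a, haug, ext_coord2 q x fun s t => ?_⟩
  rw [coord2_d1 q x haug]
  split_ifs with hst
  · rcases hst with rfl | rfl
    · rw [coord2_zero_left q x hu.1]
    · rw [coord2_zero_right q x hu.1]
  · push Not at hst
    have hst0 : s + t ≠ 0 := fun h => hst.1 (by
      funext i; have := congrFun h i; simp at this; simp [this.1])
    rw [ha, if_neg hst0]
    rw [show coord2 q x s t u = G (s + t) from hG s t hst.1 hst.2]
    split_ifs with hb
    · rw [neg_neg]
    · rw [hG0 _ hb, neg_zero]

lemma single_mem_box (i : Fin d) : (Pi.single i 1 : Fin d → ℕ) ∈ box p d :=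
  mem_box.2 fun j => by
    have := (Fact.out : p.Prime).one_lt
    by_cases hj : j = i
    · subst hj; simpa using this
    · simp [hj]; omega

lemma divMon_single (i : Fin d) : divMon q x (Pi.single i 1) = ι q (x i) := by
  rw [divMon, Finset.prod_eq_single i] <;> simp +contextual

lemma coord_basis (s : Fin d → ℕ) (i : Fin d) :
    coord q x s (ι q (x i)) = if Pi.single i 1 = s then 1 else 0 := by
  rw [← divMon_single, coord_divMon q x s (single_mem_box i)]

lemma coord_single_ι (c : Fin d → k) (i : Fin d) :
    coord q x (Pi.single i 1) (ι q (∑ j, c j • x j)) = c i := by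
  rw [map_sum, map_sum, Finset.sum_eq_single i]
  · simp [coord_basis]
  · intro j _ hj
    rw [map_smul, map_smul, coord_basis, if_neg, smul_zero]
    intro h
    have := congrFun h j
    simp [hj] at this
  · simp

lemma coord_ι_of_sum_ne {s : Fin d → ℕ} (hs : ∑ i, s i ≠ 1) (v : h) :
    coord q x s (ι q v) = 0 := by
  have := coord_pow q x (Fact.out : p.Prime).one_lt (x.repr v) s
  rwa [x.sum_repr, pow_one, if_neg hs] at this

lemma ι_mem_aug (v : h) : ι q v ∈ aug q := counit_ι q v

/-- A coordinate at an exponent `e_i + ρ` with `ρ ≠ 0` is, up to sign, a coordinate of `d1 q a`.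
Thus primitive elements have coordinates only at the unit exponents. -/
lemma eq_ι_of_d1_eq_zero {a : RestrictedEnv q} (ha : a ∈ aug q) (h : d1 q a = 0) :
    a = ι q (∑ i, coord q x (Pi.single i 1) a • x i) := by
  refine ext_coord q x fun s => ?_
  by_cases h0 : s = 0
  · subst h0
    rw [(mem_aug q x).1 ha, coord_ι_of_sum_ne q x (by simp)]
  · obtain ⟨i, hi⟩ := Function.ne_iff.1 h0
    have hs' : s = Pi.single i 1 + (s - Pi.single i 1) := by
      rw [add_tsub_cancel_of_le]
      intro l
      by_cases hl : l = i
      · subst hl; simp at hi ⊢; omega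
      · simp [hl]
    generalize s - Pi.single i 1 = ρ at hs'
    by_cases hρ : ρ = 0
    · rw [hs', hρ, add_zero, coord_single_ι]
    · have h1 := coord2_d1 q x ha (Pi.single i 1) ρ
      rw [h, map_zero, if_neg (by simp [hρ]), ← hs', eq_comm, neg_eq_zero] at h1
      rw [h1, coord_ι_of_sum_ne]
      rw [hs']
      simp only [Pi.add_apply, Finset.sum_add_distrib, Finset.sum_pi_single', Finset.mem_univ,
        if_true]
      intro h2
      apply hρ
      funext j
      exact Finset.sum_eq_zero_iff.1 (by omega : ∑ j, ρ j = 0) j (Finset.mem_univ j)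

lemma d1_ι (v : h) : d1 q (ι q v) = 0 := by
  rw [d1, LinearMap.neg_apply, redComul]
  simp [comul_ι]

lemma coord_of_mem_ge2 {a : RestrictedEnv q} (ha : a ∈ ge2 q x) {s : Fin d → ℕ}
    (hs : ∑ i, s i < 2) : coord q x s a = 0 := by
  induction ha using Submodule.span_induction with
  | mem a ha =>
    obtain ⟨t, ht, ht2, rfl⟩ := ha
    rw [prod_pow_eq_smul_divMon q x (mem_box.2 ht), map_smul, coord_divMon q x s (mem_box.2 ht),
      if_neg, smul_zero]
    rintro rfl
    omega
  | zero => exact map_zero _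
  | add a b _ _ ha hb => rw [map_add, ha, hb, add_zero]
  | smul c a _ ha => rw [map_smul, ha, smul_zero]

lemma mem_aug_of_mem_ge2 {a : RestrictedEnv q} (ha : a ∈ ge2 q x) : a ∈ aug q := by
  rw [mem_aug q x]
  exact coord_of_mem_ge2 q x ha (by simp)

/-- The differential `d¹` is injective on `A_{≥ 2}`. -/
lemma eq_of_d1_eq {a b : RestrictedEnv q} (ha : a ∈ ge2 q x) (hb : b ∈ ge2 q x)
    (h : d1 q a = d1 q b) : a = b := by
  have hab := sub_mem ha hb
  have h0 := eq_ι_of_d1_eq_zero q x (mem_aug_of_mem_ge2 q x hab) (by rw [map_sub, h, sub_self])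
  have h1 : ∀ i : Fin d, coord q x (Pi.single i 1) (a - b) = 0 := fun i =>
    coord_of_mem_ge2 q x hab (by simp)
  rw [← sub_eq_zero, h0]
  simp [h1]

/-- This splitting `A⁺ = A_{≥ 2} + h` is what separates `Ψ_P` from `Θ_P`. -/
lemma exists_ge2_add_ι {a : RestrictedEnv q} (ha : a ∈ aug q) :
    ∃ b ∈ ge2 q x, ∃ c : Fin d → k, a = b + ι q (∑ i, c i • x i) := by
  refine ⟨∑ t ∈ box p d, (if 2 ≤ ∑ i, t i then coord q x t a else 0) • divMon q x t, ?_,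
    fun i => coord q x (Pi.single i 1) a, ext_coord q x fun s => ?_⟩
  · refine sum_mem fun t ht => ?_
    split_ifs with h2
    · refine Submodule.smul_mem _ _ ?_
      rw [divMon_eq_smul]
      exact Submodule.smul_mem _ _ (Submodule.subset_span ⟨t, mem_box.1 ht, h2, rfl⟩)
    · rw [zero_smul]
      exact zero_mem _
  · rw [map_add, coord_sum_divMon]
    by_cases h2 : 2 ≤ ∑ i, s i
    · rw [if_pos h2, coord_ι_of_sum_ne q x (by omega), add_zero]
      split_ifs with hs
      · rfl
      · rw [coord_eq_zero q x hs, LinearMap.zero_apply]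
    · rw [if_neg h2, ite_self, zero_add]
      by_cases h0 : s = 0
      · subst h0
        rw [(mem_aug q x).1 ha, coord_ι_of_sum_ne q x (by simp)]
      · obtain ⟨i, hi⟩ := Function.ne_iff.1 h0
        have hs : s = Pi.single i 1 := by
          have h3 := Finset.add_sum_erase Finset.univ s (Finset.mem_univ i)
          have hi' : s i ≠ 0 := hi
          funext j
          by_cases hj : j = i
          · subst hj; simp; omega
          · have h4 : ∑ l ∈ Finset.univ.erase i, s l = 0 := by omega
            rw [Finset.sum_eq_zero_iff.1 h4 j (by simp [hj])]
            simp [hj]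
        rw [hs, coord_single_ι]

lemma choose_div_mul_factorial {i : ℕ} (hi : i ∈ Finset.Ioo 0 p) :
    p.choose i / p * (i.factorial * (p - i).factorial) = (p - 1).factorial := by
  rw [Finset.mem_Ioo] at hi
  have hp : p.Prime := Fact.out
  obtain ⟨m, hm⟩ := hp.dvd_choose_self hi.1.ne' hi.2
  have h1 := Nat.choose_mul_factorial_mul_factorial hi.2.le
  rw [hm, ← Nat.mul_factorial_pred hp.ne_zero] at h1
  rw [hm, Nat.mul_div_cancel_left _ hp.pos]
  apply Nat.eq_of_mul_eq_mul_left hp.pos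
  rw [← h1]
  ring

/-- The coordinates depend only on `s + t`, as if `ω(v)` were up to sign the coboundary of `v ^ p /
p`. No such element exists, since exponents `p e_i` lie outside the box. The cocycle property is
then immediate. -/
lemma coord2_omega (c : Fin d → k) (s t : Fin d → ℕ) :
    coord2 q x s t (omega q (ι q (∑ i, c i • x i))) =
      if s ≠ 0 ∧ t ≠ 0 ∧ ∑ i, (s + t) i = p then
        ((p - 1).factorial : k) * ∏ i, c i ^ (s + t) i else 0 := by
  have hsum : ∀ s : Fin d → ℕ, s ≠ 0 ↔ 0 < ∑ i, s i := by
    intro s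
    rw [Nat.pos_iff_ne_zero, Ne, Ne, not_iff_not, Finset.sum_eq_zero_iff]
    simp [funext_iff]
  have hterm : ∀ i ∈ Finset.Ioo 0 p, coord2 q x s t (((p.choose i / p : ℕ) : k) •
      ((ι q (∑ i, c i • x i) ^ i) ⊗ₜ[k] (ι q (∑ i, c i • x i) ^ (p - i)))) =
      if i = ∑ j, s j then (if ∑ j, t j = p - i then
        ((p - 1).factorial : k) * ∏ i, c i ^ (s + t) i else 0) else 0 := by
    intro i hi
    have hi' := Finset.mem_Ioo.1 hi
    rw [map_smul, coord2_tmul, coord_pow q x hi'.2, coord_pow q x (by omega : p - i < p),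
      ← choose_div_mul_factorial hi]
    by_cases h1 : i = ∑ j, s j
    · rw [if_pos h1.symm, if_pos h1]
      split_ifs with h2
      · simp only [Pi.add_apply, pow_add, Finset.prod_mul_distrib, smul_eq_mul]
        push_cast
        ring
      · simp
    · rw [if_neg (Ne.symm h1), if_neg h1, zero_mul, smul_zero]
  rw [omega, map_sum, Finset.sum_congr rfl hterm, Finset.sum_ite_eq', ← ite_and]
  refine if_congr ?_ rfl rfl
  rw [hsum, hsum]
  simp only [Finset.mem_Ioo, Pi.add_apply, Finset.sum_add_distrib]
  omega

lemma omega_mem_aug2 {a : RestrictedEnv q} (ha : a ∈ aug q) : omega q a ∈ aug2 q := by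
  have hpow : ∀ n, 0 < n → a ^ n ∈ aug q := by
    intro n hn
    have h0 : counit q a = 0 := ha
    change counit q (a ^ n) = 0
    rw [map_pow, h0, zero_pow hn.ne']
  refine sum_mem fun i hi => ?_
  rw [Finset.mem_Ioo] at hi
  exact Submodule.smul_mem _ _ (tmul_mem_aug2 q (hpow i hi.1) (hpow _ (by omega)))

lemma omega_mem_Z2 (c : Fin d → k) : omega q (ι q (∑ i, c i • x i)) ∈ Z2 q := by
  have h2 := omega_mem_aug2 q (ι_mem_aug q (∑ i, c i • x i))
  rw [mem_Z2_iff q x h2]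
  intro r s t hr hs ht
  rw [coord2_omega, coord2_omega, add_assoc]
  have hadd : ∀ s t : Fin d → ℕ, s ≠ 0 → s + t ≠ 0 := by
    intro s t hs h
    apply hs
    funext i
    have := congrFun h i
    simp at this
    simp [this.1]
  simp [hr, ht, hadd _ _ hs, hadd _ _ hr]

lemma tmul_basis_mem_Z2 (i j : Fin d) : ι q (x i) ⊗ₜ[k] ι q (x j) ∈ Z2 q := by
  refine ⟨tmul_mem_aug2 q (ι_mem_aug q _) (ι_mem_aug q _), ?_⟩
  have h0 : ∀ v, redComul q (ι q v) = 0 := fun v => by simpa [d1] using d1_ι q v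
  refine LinearMap.mem_ker.2 ?_
  simp [d2, h0]

end Cohomology

end RestrictedEnv
end ConnHopf

/-! ### The derivation `ρ_z` and the operators `Φ_z`. -/

namespace ConnHopf
namespace RepType

noncomputable section Action

variable {k : Type*} [Field k] {p : ℕ} [Fact p.Prime] [CharP k p]
variable {g h : Type*} [AddCommGroup g] [Module k g] [AddCommGroup h] [Module k h]
variable (T : RepType k p g h)

lemma act_one (z : g) : T.act z 1 = 0 := by
  have := T.act_mul z 1 1
  simpa using this

lemma act_algebraMap (z : g) (c : k) : T.act z (algebraMap k T.A c) = 0 := by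
  rw [Algebra.algebraMap_eq_smul_one, map_smul, act_one, smul_zero]

lemma act_pow_p (z : g) (a : T.A) : T.act z (a ^ p) = 0 := by
  have hp : ((p : ℕ) : T.A) = 0 := by
    rw [← map_natCast (algebraMap k T.A), CharP.cast_eq_zero, map_zero]
  change (T.actDual z (a ^ p)).snd = 0
  rw [map_pow, TrivSqZeroExt.snd_pow, nsmul_eq_mul, hp, zero_mul]

lemma counit_act (z : g) (a : T.A) : RestrictedEnv.counit T.ph (T.act z a) = 0 := by
  induction a using RestrictedEnv.induction with
  | algebraMap c => rw [act_algebraMap, map_zero]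
  | ι v => rw [act_ι, RestrictedEnv.counit_ι]
  | mul a b ha hb => rw [act_mul, map_add, map_mul, map_mul, ha, hb, zero_mul, mul_zero, add_zero]
  | add a b ha hb => rw [map_add, map_add, ha, hb, add_zero]

lemma act2_tmul (z : g) (a b : T.A) :
    T.act2 z (a ⊗ₜ b) = T.act z a ⊗ₜ b + a ⊗ₜ T.act z b := by
  simp [act2]

lemma act2_mul (z : g) (u v : T.A ⊗[k] T.A) :
    T.act2 z (u * v) = T.act2 z u * v + u * T.act2 z v := by
  induction u using TensorProduct.induction_on with
  | zero => simp
  | add u₁ u₂ h₁ h₂ => rw [add_mul, map_add, h₁, h₂, map_add]; ring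
  | tmul a b =>
    induction v using TensorProduct.induction_on with
    | zero => simp
    | add v₁ v₂ h₁ h₂ => rw [mul_add, map_add, h₁, h₂, map_add]; ring
    | tmul c e =>
      simp only [Algebra.TensorProduct.tmul_mul_tmul, act2_tmul, act_mul, add_mul, mul_add,
        TensorProduct.add_tmul, TensorProduct.tmul_add]
      abel

/-- The comultiplication is equivariant. -/
lemma comul_act (z : g) (a : T.A) :
    RestrictedEnv.comul T.ph (T.act z a) = T.act2 z (RestrictedEnv.comul T.ph a) := by
  induction a using RestrictedEnv.induction with
  | algebraMap c =>
    rw [act_algebraMap, map_zero, AlgHom.commutes, Algebra.algebraMap_eq_smul_one, map_smul,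
      Algebra.TensorProduct.one_def, act2_tmul, act_one]
    simp
  | ι v =>
    rw [act_ι, RestrictedEnv.comul_ι, RestrictedEnv.comul_ι, map_add, act2_tmul, act2_tmul,
      act_one, act_ι]
    simp
  | mul a b ha hb => rw [act_mul, map_add, map_mul, map_mul, map_mul, ha, hb, act2_mul]
  | add a b ha hb => rw [map_add, map_add, map_add, map_add, ha, hb]

lemma d1_apply (a : T.A) : RestrictedEnv.d1 T.ph a =
    -(RestrictedEnv.comul T.ph a - a ⊗ₜ 1 - 1 ⊗ₜ a) := rfl

lemma d1_act (z : g) (a : T.A) :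
    RestrictedEnv.d1 T.ph (T.act z a) = T.act2 z (RestrictedEnv.d1 T.ph a) := by
  rw [d1_apply, d1_apply, comul_act, map_neg, map_sub, map_sub, act2_tmul, act2_tmul, act_one]
  simp

lemma d1_act_pow (z : g) (n : ℕ) (a : T.A) :
    RestrictedEnv.d1 T.ph ((T.act z ^ n) a) = (T.act2 z ^ n) (RestrictedEnv.d1 T.ph a) := by
  induction n with
  | zero => simp
  | succ n ih => rw [pow_succ', pow_succ', Module.End.mul_apply, d1_act, ih, Module.End.mul_apply]

lemma sub_pow_p (k : Type*) [Field k] {p : ℕ} [Fact p.Prime] [CharP k p] {R : Type*}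
    [CommRing R] [Algebra k R] (a b : R) : (a - b) ^ p = a ^ p - b ^ p := by
  rw [eq_sub_iff_add_eq, ← RestrictedEnv.add_pow_p k, sub_add_cancel]

lemma neg_pow_p (k : Type*) [Field k] {p : ℕ} [Fact p.Prime] [CharP k p] {R : Type*}
    [CommRing R] [Algebra k R] (a : R) : (-a) ^ p = -a ^ p := by
  rw [← zero_sub, sub_pow_p k, zero_pow (Fact.out : p.Prime).ne_zero, zero_sub]

lemma d1_pow_p (a : T.A) : RestrictedEnv.d1 T.ph (a ^ p) = RestrictedEnv.d1 T.ph a ^ p := by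
  rw [d1_apply, d1_apply, neg_pow_p k, sub_pow_p k, sub_pow_p k, map_pow,
    Algebra.TensorProduct.tmul_pow, Algebra.TensorProduct.tmul_pow, one_pow]

/-- The operators `Φ_z` commute with the differential. -/
lemma d1_phi1 (z : g) (lam : k) (a : T.A) :
    RestrictedEnv.d1 T.ph (T.phi1 z lam a) = T.phi2 z lam (RestrictedEnv.d1 T.ph a) := by
  rw [phi1, phi2, map_add, map_add, map_smul, d1_act_pow, d1_pow_p]

lemma phi2_sub (z : g) (lam : k) (u v : T.A ⊗[k] T.A) :
    T.phi2 z lam (u - v) = T.phi2 z lam u - T.phi2 z lam v := by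
  simp only [phi2, sub_pow_p k, map_sub, smul_sub]
  abel

lemma phi1_mem_aug (z : g) (lam : k) {a : T.A} (ha : a ∈ RestrictedEnv.aug T.ph) :
    T.phi1 z lam a ∈ RestrictedEnv.aug T.ph := by
  have hp : p.Prime := Fact.out
  have h0 : RestrictedEnv.counit T.ph a = 0 := ha
  change RestrictedEnv.counit T.ph (T.phi1 z lam a) = 0
  -- Since `p - 1 ≥ 1`, an outermost `ρ_z` is available, and its image lies in the kernel of the
  -- counit.
  obtain ⟨n, hn⟩ : ∃ n, p - 1 = n + 1 := ⟨p - 2, by have := hp.two_le; omega⟩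
  rw [phi1, hn, pow_succ', Module.End.mul_apply, map_add, map_add, map_pow, map_smul, counit_act,
    h0, zero_pow hp.ne_zero]
  simp

/-- The `p`-th power of the derivation `ρ_z` is a derivation. -/
lemma act_pow_p_mul (z : g) (a b : T.A) : (T.act z ^ p) (a * b) =
    (T.act z ^ p) a * b + a * (T.act z ^ p) b := by
  have hp : p.Prime := Fact.out
  -- The two summands of `act2` commute, so in characteristic `p` the `p`-th power of their sum is
  -- the sum of their `p`-th powers. Multiplication `A ⊗ A → A` intertwines `act2` with `act`, which
  -- transports this to `A`.
  have hcomm : Commute (LinearMap.rTensor T.A (T.act z)) (LinearMap.lTensor T.A (T.act z)) :=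
    TensorProduct.ext' fun a b => by simp
  have hchar : ((p : ℕ) : Module.End k (T.A ⊗[k] T.A)) = 0 := by
    rw [← map_natCast (algebraMap k (Module.End k (T.A ⊗[k] T.A))), CharP.cast_eq_zero, map_zero]
  have h1 : T.act2 z ^ p = LinearMap.rTensor T.A (T.act z ^ p) +
      LinearMap.lTensor T.A (T.act z ^ p) := by
    obtain ⟨r, hr⟩ := hcomm.exists_add_pow_prime_eq hp
    rw [act2, hr, hchar, zero_mul, zero_mul, zero_mul, add_zero, LinearMap.rTensor_pow,
      LinearMap.lTensor_pow]
  have h2 : ∀ (n : ℕ) (u : T.A ⊗[k] T.A), (T.act z ^ n) (LinearMap.mul' k T.A u) =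
      LinearMap.mul' k T.A ((T.act2 z ^ n) u) := by
    intro n u
    induction n with
    | zero => simp
    | succ n ih =>
      rw [pow_succ', pow_succ', Module.End.mul_apply, ih, Module.End.mul_apply]
      generalize (T.act2 z ^ n) u = v
      induction v using TensorProduct.induction_on with
      | zero => simp
      | tmul a b => simp [act2_tmul, act_mul]
      | add v w hv hw => simp only [map_add, hv, hw]
  have h3 := h2 p (a ⊗ₜ b)
  rw [h1] at h3
  simpa using h3

lemma act_pow_ι (z : g) (n : ℕ) (v : h) : (T.act z ^ n) (RestrictedEnv.ι T.ph v) =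
    RestrictedEnv.ι T.ph ((T.rho z ^ n) v) := by
  induction n with
  | zero => simp
  | succ n ih => rw [pow_succ', pow_succ', Module.End.mul_apply, ih, act_ι, Module.End.mul_apply]

/-- The operator `ρ_z ^ p + λ ρ_z` is a derivation, and on `h` it is the action of `z^[p] + λ z =
0`. -/
lemma act_pow_p_add {z : g} {lam : k} (hlam : T.pg z + lam • z = 0) (a : T.A) :
    (T.act z ^ p) a + lam • T.act z a = 0 := by
  induction a using RestrictedEnv.induction with
  | algebraMap c =>
    rw [← pow_sub_one_mul (Fact.out : p.Prime).ne_zero, Module.End.mul_apply, act_algebraMap]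
    simp
  | ι v =>
    rw [act_pow_ι, ← T.rho_pg, act_ι, ← map_smul, ← map_add, ← LinearMap.smul_apply,
      ← LinearMap.add_apply, ← map_smul, ← map_add, hlam]
    simp
  | mul a b ha hb =>
    rw [act_pow_p_mul, act_mul, smul_add]
    have : (T.act z ^ p) a * b + a * (T.act z ^ p) b +
        (lam • (T.act z a * b) + lam • (a * T.act z b)) =
        ((T.act z ^ p) a + lam • T.act z a) * b + a * ((T.act z ^ p) b + lam • T.act z b) := by
      simp only [add_mul, mul_add, smul_mul_assoc, mul_smul_comm]
      abel
    rw [this, ha, hb, zero_mul, mul_zero, add_zero]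
  | add a b ha hb =>
    rw [map_add, map_add, smul_add, add_add_add_comm, ha, hb, add_zero]

/-- The term `a ^ p` is killed by any derivation, and the rest is `(ρ_z ^ p + λ ρ_z)(a)`.
Consequently changing `Θ` by `Φ_z(a)` preserves the condition `ρ_z(Θ) = 0`. -/
lemma act_phi1 {z : g} {lam : k} (hlam : T.pg z + lam • z = 0) (a : T.A) :
    T.act z (T.phi1 z lam a) = 0 := by
  rw [phi1, map_add, map_add, act_pow_p, zero_add, map_smul, ← Module.End.mul_apply, ← pow_succ',
    Nat.sub_add_cancel (Fact.out : p.Prime).one_le]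
  exact T.act_pow_p_add hlam a

end Action

section Exponents

lemma single_eq_single_iff {d : ℕ} {i j : Fin d} :
    (Pi.single i 1 : Fin d → ℕ) = Pi.single j 1 ↔ i = j :=
  ⟨fun h => by
    by_contra hij
    have := congrFun h i
    simp [Pi.single_eq_of_ne hij] at this, fun h => by rw [h]⟩

lemma single_notMem_box {p d : ℕ} (i : Fin d) :
    (Pi.single i (1 + (p - 1)) : Fin d → ℕ) ∉ RestrictedEnv.box p d := by
  rw [RestrictedEnv.mem_box]
  intro h
  have := h i
  simp at this
  omega

end Exponents

/-! ### The coordinates `(b, c)` as a complete set of invariants of degree-two classes. -/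

noncomputable section Parametrization

open RestrictedEnv

variable {k : Type*} [Field k] {p : ℕ} [Fact p.Prime] [CharP k p]
variable {g h : Type*} [AddCommGroup g] [Module k g] [AddCommGroup h] [Module k h]
variable (T : RepType k p g h) {d : ℕ} (x : Module.Basis (Fin d) k h)

lemma coord_single_basis (i j : Fin d) :
    coord T.ph x (Pi.single j 1) (ι T.ph (x i)) = if i = j then 1 else 0 := by
  rw [coord_basis]
  exact if_congr single_eq_single_iff rfl rfl

lemma chiP_mem_Z2 (P : Points k d) : T.chiP x P ∈ Z2 T.ph :=
  add_mem (sum_mem fun _ _ => Submodule.smul_mem _ _ (tmul_basis_mem_Z2 T.ph x _ _))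
    (omega_mem_Z2 T.ph x _)

/-- The coordinates of the antisymmetric part of `χ_P`. -/
lemma coord2_chiP_sub (P : Points k d) {i j : Fin d} (hij : i < j) :
    coord2 T.ph x (Pi.single i 1) (Pi.single j 1) (T.chiP x P) -
      coord2 T.ph x (Pi.single j 1) (Pi.single i 1) (T.chiP x P) = P.2.1 ⟨(i, j), hij⟩ := by
  -- The contribution of `ω` at two unit exponents, which can be nonzero only for `p = 2`, is
  -- symmetric and cancels.
  rw [chiP, map_add, map_add, coord2_omega, coord2_omega, add_comm (Pi.single j 1)]
  simp only [ne_eq, Pi.single_eq_zero_iff, one_ne_zero, not_false_eq_true, true_and,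
    add_sub_add_right_eq_sub]
  rw [map_sum, map_sum, Finset.sum_eq_single ⟨(i, j), hij⟩, Finset.sum_eq_zero, sub_zero]
  · simp [coord_single_basis]
  · rintro ⟨⟨l, m⟩, hlm⟩ _
    rw [map_smul, coord2_tmul, coord_single_basis, coord_single_basis]
    by_cases h1 : l = j
    · rw [if_neg (c := m = i), mul_zero, smul_zero]
      rintro rfl
      subst h1
      exact absurd hij (not_lt.2 hlm.le)
    · rw [if_neg h1, zero_mul, smul_zero]
  · rintro ⟨⟨l, m⟩, hlm⟩ _ hne
    rw [map_smul, coord2_tmul, coord_single_basis, coord_single_basis]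
    by_cases h1 : l = i
    · rw [if_neg (c := m = j), mul_zero, smul_zero]
      rintro rfl
      subst h1
      exact hne rfl
    · rw [if_neg h1, zero_mul, smul_zero]
  · simp

/-- The coordinates of `χ_P` at the `p`-th powers. -/
lemma coord2_chiP_pow (P : Points k d) (i : Fin d) :
    coord2 T.ph x (Pi.single i 1) (Pi.single i (p - 1)) (T.chiP x P) =
      ((p - 1).factorial : k) * P.2.2 i ^ p := by
  have hp : p.Prime := Fact.out
  have hp1 : 1 + (p - 1) = p := Nat.add_sub_cancel' hp.one_le
  rw [chiP, map_add, coord2_omega, ← Pi.single_add, hp1, if_pos, map_sum, Finset.sum_eq_zero,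
    zero_add, Finset.prod_eq_single i]
  · simp
  · intro j _ hj
    rw [Pi.single_eq_of_ne hj, pow_zero]
  · simp
  -- A term `x_l ⊗ x_m` would need `l = i` and `e_m = (p - 1) e_i`, which forces `m = i` and
  -- contradicts `l < m`.
  · rintro ⟨⟨l, m⟩, hlm⟩ _
    rw [map_smul, coord2_tmul, coord_single_basis, coord_basis]
    by_cases h1 : l = i
    · rw [if_neg (c := (Pi.single m 1 : Fin d → ℕ) = _), mul_zero, smul_zero]
      intro h2
      have h3 : m ≠ i := fun h => absurd (h1.trans h.symm) (ne_of_lt hlm)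
      have := congrFun h2 m
      simp [Pi.single_eq_of_ne h3] at this
    · rw [if_neg h1, zero_mul, smul_zero]
  · refine ⟨by simp, ?_, by simp⟩
    rw [Ne, Pi.single_eq_zero_iff]
    have := hp.one_lt
    omega

lemma coord2_d1_comm {a : T.A} (ha : a ∈ aug T.ph) (s t : Fin d → ℕ) :
    coord2 T.ph x s t (d1 T.ph a) = coord2 T.ph x t s (d1 T.ph a) := by
  rw [coord2_d1 T.ph x ha, coord2_d1 T.ph x ha, add_comm t s]
  exact if_congr or_comm rfl rfl

lemma coord2_d1_pow {a : T.A} (ha : a ∈ aug T.ph) (i : Fin d) :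
    coord2 T.ph x (Pi.single i 1) (Pi.single i (p - 1)) (d1 T.ph a) = 0 := by
  rw [coord2_d1 T.ph x ha, ← Pi.single_add, coord_eq_zero T.ph x (single_notMem_box i)]
  simp

/-- The cocycles `χ_P` represent every class of degree two. -/
lemma exists_chiP [PerfectField k] {u : T.A ⊗[k] T.A} (hu : u ∈ Z2 T.ph) (a : Fin d → k) :
    ∃ bc, u - T.chiP x (a, bc) ∈ B2 T.ph := by
  have hp : p.Prime := Fact.out
  have : PerfectRing k p := inferInstance
  -- The value is forced by `coord2_chiP_pow`; perfectness of `k` supplies the `p`-th root.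
  let c : Fin d → k := fun i => (frobeniusEquiv k p).symm (((p - 1).factorial : k)⁻¹ *
    coord2 T.ph x (Pi.single i 1) (Pi.single i (p - 1)) u)
  refine ⟨(fun ij => coord2 T.ph x (Pi.single ij.1.1 1) (Pi.single ij.1.2 1) u -
    coord2 T.ph x (Pi.single ij.1.2 1) (Pi.single ij.1.1 1) u, c),
    mem_B2_of_mem_Z2 T.ph x (sub_mem hu (T.chiP_mem_Z2 x _)) (fun i j hij => ?_) fun i => ?_⟩
  · have h := T.coord2_chiP_sub x (a, (fun ij : {ij : Fin d × Fin d // ij.1 < ij.2} =>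
      coord2 T.ph x (Pi.single ij.1.1 1) (Pi.single ij.1.2 1) u -
      coord2 T.ph x (Pi.single ij.1.2 1) (Pi.single ij.1.1 1) u, c)) hij
    rw [map_sub, map_sub, sub_eq_sub_iff_sub_eq_sub, h]
  · rw [map_sub, coord2_chiP_pow, frobeniusEquiv_symm_pow_p, ← mul_assoc, mul_inv_cancel₀, one_mul,
      sub_self]
    exact factorial_ne_zero (p := p) (by have := hp.pos; omega)

/-- Coboundaries are symmetric and vanish at `(e_i, (p - 1) e_i)`, so `b_ij` and `(p - 1)! c_i ^ p`
are invariants of the class; injectivity of Frobenius recovers `c_i`. -/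
lemma eq_of_chiP_sub {P Q : Points k d} {a : T.A} (ha : a ∈ aug T.ph)
    (h : T.chiP x P - T.chiP x Q = d1 T.ph a) : P.2 = Q.2 := by
  have hp : p.Prime := Fact.out
  refine Prod.ext (funext fun ⟨⟨i, j⟩, hij⟩ => ?_) (funext fun i => ?_)
  · rw [← T.coord2_chiP_sub x P hij, ← T.coord2_chiP_sub x Q hij, sub_eq_sub_iff_sub_eq_sub,
      ← map_sub, ← map_sub, h, coord2_d1_comm T x ha]
  · have h1 := T.coord2_d1_pow x ha i
    rw [← h, map_sub, sub_eq_zero, coord2_chiP_pow, coord2_chiP_pow] at h1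
    exact frobenius_inj k p (mul_left_cancel₀
      (factorial_ne_zero (p := p) (by have := hp.pos; omega)) h1)

end Parametrization

end RepType
end ConnHopf

/-! ### Normal forms of pairs `(Θ, χ)` and the classification. -/

namespace ConnHopf
namespace RepType

noncomputable section Classification

open RestrictedEnv

variable {k : Type*} [Field k] {p : ℕ} [Fact p.Prime] [CharP k p]
variable {g h : Type*} [AddCommGroup g] [Module k g] [AddCommGroup h] [Module k h]
variable (T : RepType k p g h) {d : ℕ} (x : Module.Basis (Fin d) k h)
variable {z : g} {lam : k}

lemma psiP_mem (P : T.ST x z lam) : T.psiP x z lam P ∈ ge2 T.ph x :=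
  P.2.2.choose_spec.1

lemma phi2_chiP (P : T.ST x z lam) :
    T.phi2 z lam (T.chiP x P.1) = d1 T.ph (T.psiP x z lam P) :=
  P.2.2.choose_spec.2.1

lemma act_psiP_add (P : T.ST x z lam) : T.act z (T.psiP x z lam P + T.thetaP x P.1) = 0 :=
  P.2.2.choose_spec.2.2

lemma eq_psiP (P : T.ST x z lam) {a : T.A} (ha : a ∈ ge2 T.ph x)
    (h : T.phi2 z lam (T.chiP x P.1) = d1 T.ph a) : a = T.psiP x z lam P :=
  eq_of_d1_eq T.ph x ha (T.psiP_mem x P) (h.symm.trans (T.phi2_chiP x P))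

lemma pairP_mem_E2 (P : T.ST x z lam) : T.pairP x z lam P ∈ T.E2 z lam :=
  ⟨add_mem (mem_aug_of_mem_ge2 T.ph x (T.psiP_mem x P)) (ι_mem_aug T.ph _), T.chiP_mem_Z2 x P.1,
    T.act_psiP_add x P, by
      rw [pairP, map_add, thetaP, d1_ι, add_zero]
      exact T.phi2_chiP x P⟩

lemma snd_mem_B2_iff {X Y : T.A × (T.A ⊗[k] T.A)} (hXY : T.Equivalent z lam X Y) :
    X.2 ∈ B2 T.ph ↔ Y.2 ∈ B2 T.ph := by
  obtain ⟨a, ha, -, h2⟩ := hXY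
  have hB : X.2 - Y.2 ∈ B2 T.ph := ⟨a, ha, h2.symm⟩
  exact ⟨fun hX => by simpa using sub_mem hX hB, fun hY => by simpa using add_mem hB hY⟩

/-- If `χ - d¹(b) = χ_P`, then `b` itself gives the equivalence. The new first entry `Θ - Φ_z(b)` is
still killed by `ρ_z`, and its components in `A_{≥ 2}` and `h` are `Ψ_P` and `Θ_P`. -/
lemma exists_equivalent_pairP [PerfectField k] (hlam : T.pg z + lam • z = 0)
    {X : T.A × (T.A ⊗[k] T.A)} (hX : X ∈ T.E2 z lam) (hXL : X ∉ T.L2 z lam) :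
    ∃ P : T.ST x z lam, T.Equivalent z lam X (T.pairP x z lam P) := by
  obtain ⟨h1, h2, h3, h4⟩ := hX
  have hB : X.2 ∉ B2 T.ph := fun hB => hXL ⟨h1, hB, h3, h4⟩
  obtain ⟨bc, b, hb, hbc⟩ := T.exists_chiP x h2 0
  have haug : X.1 - T.phi1 z lam b ∈ aug T.ph := sub_mem h1 (T.phi1_mem_aug z lam hb)
  obtain ⟨a, ha, c, hac⟩ := exists_ge2_add_ι T.ph x haug
  have hchi : T.chiP x (c, bc) = X.2 - d1 T.ph b := by
    rw [hbc, sub_sub_cancel]; rfl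
  have hphi : T.phi2 z lam (T.chiP x (c, bc)) = d1 T.ph a := by
    rw [hchi, phi2_sub, h4, ← d1_phi1, ← map_sub, hac, map_add, d1_ι, add_zero]
  have hP : ((c, bc) : Points k d) ∈ T.ST x z lam := by
    refine ⟨fun h => hB ?_, a, ha, hphi, ?_⟩
    · rw [hchi] at h
      simpa using add_mem h (show d1 T.ph b ∈ B2 T.ph from ⟨b, hb, rfl⟩)
    · rw [thetaP, ← hac, map_sub, h3, T.act_phi1 hlam, sub_zero]
  refine ⟨⟨(c, bc), hP⟩, b, hb, ?_, ?_⟩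
  · rw [pairP, ← T.eq_psiP x ⟨_, hP⟩ ha hphi, thetaP, ← hac, sub_sub_cancel]
  · rw [pairP, hchi, sub_sub_cancel]

lemma quotMap_eq_iff {P Q : Points k d} : T.quotMap x z lam P = T.quotMap x z lam Q ↔
    P.2 = Q.2 ∧ ∃ v : h, T.thetaP x P - T.thetaP x Q = ι T.ph (T.phiH z lam v) := by
  have hι : ∀ v w : h, ι T.ph v = ι T.ph w → v = w := by
    intro v w hvw
    apply x.repr.injective
    ext i
    have h1 := coord_single_ι T.ph x (x.repr v) i
    have h2 := coord_single_ι T.ph x (x.repr w) i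
    rw [x.sum_repr] at h1 h2
    rw [← h1, ← h2, hvw]
  rw [quotMap, quotMap, Prod.mk.injEq, and_comm, eq_comm (a := QuotientAddGroup.mk P.1),
    QuotientAddGroup.eq]
  refine and_congr_right fun _ => exists_congr fun v => ?_
  rw [thetaP, thetaP, ← map_sub]
  have hPQ : ∑ i, P.1 i • x i - ∑ i, Q.1 i • x i = x.equivFun.symm (-Q.1 + P.1) := by
    rw [x.equivFun_symm_apply, ← Finset.sum_sub_distrib]
    refine Finset.sum_congr rfl fun i _ => ?_
    rw [← sub_smul, Pi.add_apply, Pi.neg_apply, neg_add_eq_sub]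
  rw [hPQ]
  constructor
  · intro hv
    rw [← hv]
    exact congrArg _ (x.equivFun.symm_apply_apply _)
  · intro hv
    have := hι _ _ hv
    change x.equivFun (T.phiH z lam v) = _
    rw [← this, LinearEquiv.apply_symm_apply]

/-- Two of the pairs are equivalent exactly if the points have the same image in the quotient. -/
lemma equivalent_pairP_iff (P Q : T.ST x z lam) :
    T.Equivalent z lam (T.pairP x z lam P) (T.pairP x z lam Q) ↔
      T.quotMap x z lam P.1 = T.quotMap x z lam Q.1 := by
  have hpsi : P.1.2 = Q.1.2 → T.psiP x z lam P = T.psiP x z lam Q := by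
    intro h
    refine T.eq_psiP x Q (T.psiP_mem x P) ?_
    rw [← T.phi2_chiP x P, chiP, chiP, h]
  rw [quotMap_eq_iff]
  constructor
  · rintro ⟨a, ha, h1, h2⟩
    have hbc := T.eq_of_chiP_sub x ha h2
    have h3 : d1 T.ph a = 0 := by
      rw [← h2, pairP, pairP, chiP, chiP, hbc, sub_self]
    -- Once the cocycles agree, `a` is primitive and hence equals this vector of `h`.
    refine ⟨hbc, ∑ i, coord T.ph x (Pi.single i 1) a • x i, ?_⟩
    rw [← phi1_ι, ← eq_ι_of_d1_eq_zero T.ph x ha h3, ← h1, pairP, pairP, hpsi hbc,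
      add_sub_add_left_eq_sub]
  · rintro ⟨hbc, v, hv⟩
    refine ⟨ι T.ph v, ι_mem_aug T.ph v, ?_, ?_⟩
    · rw [phi1_ι, ← hv, pairP, pairP, hpsi hbc, add_sub_add_left_eq_sub]
    · rw [d1_ι, pairP, pairP, chiP, chiP, hbc, sub_self]

lemma cls_eq_iff {X Y : T.A × (T.A ⊗[k] T.A)} (hX : X ∈ T.E2 z lam) (hY : Y ∈ T.E2 z lam) :
    T.cls z lam X hX = T.cls z lam Y hY ↔ T.Equivalent z lam X Y :=
  Quotient.eq (r := T.setoidE2 z lam)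

/-- Equivalent pairs have second entries differing by a coboundary, so membership in `L2` depends
only on the class. -/
lemma cls_mem_H2T_iff {X : T.A × (T.A ⊗[k] T.A)} (hX : X ∈ T.E2 z lam) :
    T.cls z lam X hX ∈ T.H2T z lam ↔ X ∉ T.L2 z lam := by
  refine not_congr ⟨?_, fun h => ⟨X, hX, h, rfl⟩⟩
  rintro ⟨Y, hY, hYL, h⟩
  rw [cls_eq_iff] at h
  exact ⟨hX.1, (T.snd_mem_B2_iff h).2 hYL.2.1, hX.2.2⟩

lemma pairP_notMem_L2 (P : T.ST x z lam) : T.pairP x z lam P ∉ T.L2 z lam :=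
  fun h => P.2.1 h.2.1

end Classification

end RepType
end ConnHopf

theorem proposition5p1 {k : Type*} [Field k] [PerfectField k] {p : ℕ} [Fact p.Prime] [CharP k p]
    {g h : Type*} [AddCommGroup g] [Module k g] [AddCommGroup h] [Module k h]
    (T : ConnHopf.RepType k p g h) (hg : Module.finrank k g = 1)
    (z : g) (hz : z ≠ 0) (lam : k) (hlam : T.pg z + lam • z = 0)
    (d : ℕ) (x : Module.Basis (Fin d) k h) :
    -- for `P ∈ S_T`, the element `a = Ψ_P` of `A_{≥ 2}` with `Φ_z(χ_P) = d¹(a)` is unique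
    (∀ P : T.ST x z lam, T.psiP x z lam P ∈ ConnHopf.RestrictedEnv.ge2 T.ph x ∧
      ∀ a ∈ ConnHopf.RestrictedEnv.ge2 T.ph x,
      (T.phi2 z lam (T.chiP x P.1) = ConnHopf.RestrictedEnv.d1 T.ph a ↔
        a = T.psiP x z lam P)) ∧
    -- the pairs `(Ψ_P + Θ_P, χ_P)` represent all classes in `𝓔²(B,A) ∖ 𝓛²(g,h)`
    (∀ P : T.ST x z lam, T.pairP x z lam P ∈ T.E2 z lam \ T.L2 z lam) ∧
    (∀ X ∈ T.E2 z lam \ T.L2 z lam, ∃ P : T.ST x z lam,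
      T.Equivalent z lam X (T.pairP x z lam P)) ∧
    -- `π(P) ↦ [(Ψ_P + Θ_P, χ_P)]` is a well-defined bijection from `π(S_T)` to `𝓗²(T)`
    (∃ e : (T.quotMap x z lam '' T.ST x z lam) ≃ T.H2T z lam,
      ∀ P : T.ST x z lam, ∃ hP : T.pairP x z lam P ∈ T.E2 z lam,
        (e ⟨T.quotMap x z lam P.1, Set.mem_image_of_mem _ P.2⟩ : T.H2BA z lam) =
          T.cls z lam (T.pairP x z lam P) hP) := by
  refine ⟨fun P => ⟨T.psiP_mem x P, fun a ha => ⟨T.eq_psiP x P ha, fun h => ?_⟩⟩,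
    fun P => ⟨T.pairP_mem_E2 x P, T.pairP_notMem_L2 x P⟩,
    fun X hX => T.exists_equivalent_pairP x hlam hX.1 hX.2, ?_⟩
  · rw [h]
    exact T.phi2_chiP x P
  · let F : T.ST x z lam → T.H2T z lam := fun P =>
      ⟨T.cls z lam (T.pairP x z lam P) (T.pairP_mem_E2 x P),
        (T.cls_mem_H2T_iff _).2 (T.pairP_notMem_L2 x P)⟩
    have hF : ∀ P Q, F P = F Q ↔ T.quotMap x z lam P.1 = T.quotMap x z lam Q.1 := fun P Q => by
      rw [Subtype.ext_iff, T.cls_eq_iff, T.equivalent_pairP_iff]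
    -- A section of `π` over `π(S_T)`. By `hF` the class is constant on fibres of `π` and separates
    -- them, so the map does not depend on this choice and is injective.
    choose s hs hsm using fun y : T.quotMap x z lam '' T.ST x z lam => y.2
    have hbij : Function.Bijective fun y => F ⟨s y, hs y⟩ := by
      refine ⟨fun y y' h => ?_, ?_⟩
      · have := (hF _ _).1 h
        rw [hsm, hsm] at this
        exact Subtype.ext this
      · rintro ⟨c, hc⟩
        induction c using Quotient.inductionOn with
        | h X =>
          obtain ⟨P, hP⟩ := T.exists_equivalent_pairP x hlam X.2 ((T.cls_mem_H2T_iff X.2).1 hc)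
          refine ⟨⟨_, Set.mem_image_of_mem _ P.2⟩, ?_⟩
          have h1 : F P = ⟨_, hc⟩ :=
            Subtype.ext ((T.cls_eq_iff (T.pairP_mem_E2 x P) X.2).2
              ((T.equivalence_equivalent z lam).symm hP))
          rw [← h1]
          exact (hF _ _).2 (hsm _)
    refine ⟨Equiv.ofBijective _ hbij, fun P => ⟨T.pairP_mem_E2 x P, ?_⟩⟩
    exact congrArg Subtype.val ((hF _ P).2 (hsm _))
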